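/- For a partition $\lambda=(\lambda_1,\dots,\lambda_k)$, let $K_\lambda$ be the complete multipartite graph with stable sets of sizes $\lambda_1,\dots,\lambda_k$; it is the incomparability graph of the poset $P_\lambda$ that is the disjoint union of chains of lengths $\lambda_1,\dots,\lambda_k$. Exponents denote repeated parts. Let $N_{\mathrm{sp}}(K_\lambda)$ be the number of sequences $(v_1,\dots,v_n)$ that contain every element of $P_\lambda$ exactly once and satisfy $v_i\not\le v_{i+1}$ in $P_\lambda$ for $1\le i\le n-1$ (so $N_{\mathrm{sp}}=1$ for the graph with no vertices). For a finite graph $G$ let $X_G=\sum_{\mathcal C}\prod_{v\in V(G)}x_{\mathcal C(v)}$, summed over all proper colorings $\mathcal C$ of $G$ with colors $1,2,3,\dots$, be its chromatic symmetric function, and let $[s_\mu]X_G$ be the coefficient of the Schur function $s_\mu$ in the expansion of $X_G$ in the Schur basis of the algebra of symmetric functions over $\mathbb Q$. The graph $G$ is Schur-positive if $[s_\mu]X_G\ge 0$ for all partitions $\mu$. **Theorem.** Let $\beta\ge 1$ be an integer. Then $K_{(3,2^\beta)}$ is Schur-positive. Moreover: 1. for all integers $C,D\ge 0$ with $2C+D=2\beta$,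 $$[s_{(3,2^C,1^D)}]X_{K_{(3,2^\beta)}}=[s_{(2^C,1^D)}]X_{K_{(2^\beta)}}=\frac{\beta!}{(\beta-C)!}\,N_{\mathrm{sp}}(K_{(2^{\beta-C})});$$ 2. for all integers $C,D\ge 1$ with $2C+D=2\beta+3$, $$[s_{(2^C,1^D)}]X_{K_{(3,2^\beta)}}=\frac{\beta!}{(\beta-C+1)!}\Big((\beta-C+1)\,N_{\mathrm{sp}}(K_{(3,2^{\beta-C})})-N_{\mathrm{sp}}(K_{(2^{\beta-C+1})})+(C+2)\,N_{\mathrm{sp}}(K_{(2^{\beta-C+1},1)})\Big),$$ where $N_{\mathrm{sp}}(K_{(3,2^{\beta-C})})$ is set equal to $0$ if $\beta<C$; 3. $[s_{(1^{2\beta+3})}]X_{K_{(3,2^\beta)}}=N_{\mathrm{sp}}(K_{(3,2^\beta)})$. -/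

import Mathlib

open scoped Nat

noncomputable section

namespace ChromSchur

/-! ### Generating series, Schur functions, Schur coefficients

Symmetric functions are realised as formal power series over `ℚ` in the countably many variables
`x₀, x₁, x₂, …` (the variable written `x₁` on paper is `x₀` here, and so on). -/

/-- The formal power series `∑ i, x ^ (wt i)`: the coefficient of a monomial `m` is the number of
indices `i` of weight `m` (all weights used below have finite fibres). -/
def genSeries {ι : Type*} (wt : ι → (ℕ →₀ ℕ)) : MvPowerSeries ℕ ℚ :=
  fun m => (Nat.card {i : ι // wt i = m} : ℚ)

/-- The exponent vector of a semistandard Young tableau: its value at `k` is the number of cells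
with entry `k`. -/
def tableauWeight {μ : YoungDiagram} (T : SemistandardYoungTableau μ) : ℕ →₀ ℕ :=
  ∑ c ∈ μ.cells, Finsupp.single (T c.1 c.2) 1

/-- The Schur function `s_μ`, the sum of the weights of all semistandard tableaux of shape `μ`. -/
def schur (μ : YoungDiagram) : MvPowerSeries ℕ ℚ :=
  genSeries (tableauWeight (μ := μ))

theorem tableauWeight_apply {μ : YoungDiagram} (T : SemistandardYoungTableau μ) (k : ℕ) :
    tableauWeight T k = (μ.cells.filter (fun c => T c.1 c.2 = k)).card := by
  classical
  rw [Finset.card_filter, tableauWeight, Finsupp.finsetSum_apply]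
  simp only [Finsupp.single_apply]

theorem finite_tableaux {μ : YoungDiagram} (m : ℕ →₀ ℕ) :
    Finite {T : SemistandardYoungTableau μ // tableauWeight T = m} := by
  classical
  let f : {T : SemistandardYoungTableau μ // tableauWeight T = m} → (μ.cells → m.support) :=
    fun T c => ⟨T.1 c.1.1 c.1.2, by
      have h := tableauWeight_apply T.1 (T.1 c.1.1 c.1.2)
      rw [T.2] at h
      rw [Finsupp.mem_support_iff, h]
      exact Finset.card_ne_zero_of_mem (Finset.mem_filter.2 ⟨c.2, rfl⟩)⟩
  refine Finite.of_injective f ?_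
  intro S T h
  apply Subtype.ext
  apply SemistandardYoungTableau.ext
  intro i j
  by_cases hc : (i, j) ∈ μ
  · have := congrArg Subtype.val (congrFun h ⟨(i, j), hc⟩)
    exact this
  · rw [S.1.zeros hc, T.1.zeros hc]

theorem le_entry {μ : YoungDiagram} (T : SemistandardYoungTableau μ) :
    ∀ {i j : ℕ}, (i, j) ∈ μ → i ≤ T i j
  | 0, _, _ => Nat.zero_le _
  | i + 1, _, h =>
    Nat.succ_le_of_lt (lt_of_le_of_lt
      (le_entry T (μ.up_left_mem (Nat.le_succ i) le_rfl h)) (T.col_strict (Nat.lt_succ_self i) h))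

/-- The exponent vector `(μ₁, μ₂, …)`. -/
def shapeWeight (μ : YoungDiagram) : ℕ →₀ ℕ :=
  tableauWeight (SemistandardYoungTableau.highestWeight μ)

theorem shapeWeight_apply (μ : YoungDiagram) (k : ℕ) : shapeWeight μ k = μ.rowLen k := by
  rw [shapeWeight, tableauWeight_apply, YoungDiagram.rowLen_eq_card, YoungDiagram.row]
  congr 1
  apply Finset.filter_congr
  rintro ⟨i, j⟩ hc
  have hc' : (i, j) ∈ μ := hc
  simp [hc']

theorem sum_tableauWeight {μ : YoungDiagram} (T : SemistandardYoungTableau μ) (n : ℕ) :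
    ∑ k ∈ Finset.range n, tableauWeight T k = (μ.cells.filter (fun c => T c.1 c.2 < n)).card := by
  classical
  rw [Finset.card_eq_sum_card_fiberwise (f := fun c => T c.1 c.2) (t := Finset.range n)]
  · apply Finset.sum_congr rfl
    intro k hk
    rw [tableauWeight_apply, Finset.filter_filter]
    congr 1
    apply Finset.filter_congr
    intro c _
    have := Finset.mem_range.1 hk
    constructor
    · intro h
      exact ⟨by omega, h⟩
    · exact fun h => h.2
  · intro c hc
    have := (Finset.mem_filter.1 hc).2
    exact Finset.mem_coe.2 (Finset.mem_range.2 this)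

theorem dominance {μ ν : YoungDiagram} (T : SemistandardYoungTableau μ)
    (h : tableauWeight T = shapeWeight ν) (n : ℕ) :
    ∑ k ∈ Finset.range n, ν.rowLen k ≤ ∑ k ∈ Finset.range n, μ.rowLen k := by
  have h1 : ∑ k ∈ Finset.range n, ν.rowLen k = ∑ k ∈ Finset.range n, tableauWeight T k := by
    simp [h, shapeWeight_apply]
  have h2 : ∑ k ∈ Finset.range n, μ.rowLen k = ∑ k ∈ Finset.range n,
      tableauWeight (SemistandardYoungTableau.highestWeight μ) k :=
    Finset.sum_congr rfl fun k _ => (shapeWeight_apply μ k).symm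
  rw [h1, h2, sum_tableauWeight, sum_tableauWeight]
  apply Finset.card_le_card
  rintro ⟨i, j⟩ hc
  obtain ⟨hc, hlt⟩ := Finset.mem_filter.1 hc
  have hc' : (i, j) ∈ μ := hc
  refine Finset.mem_filter.2 ⟨hc, ?_⟩
  simpa [hc'] using lt_of_le_of_lt (le_entry T hc') hlt

/-- The Schur functions are linearly independent, so coefficients in the Schur basis are
well defined. -/
theorem linearIndependent_schur : LinearIndependent ℚ schur := by
  classical
  rw [linearIndependent_iff]
  intro c hc
  by_contra hne
  have hsupp : c.support.Nonempty := Finsupp.support_nonempty_iff.2 hne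
  let D : YoungDiagram → (ℕ → ℕ) := fun μ n => ∑ k ∈ Finset.range n, μ.rowLen k
  have hD : Function.Injective D := by
    intro μ ν h
    ext ⟨i, j⟩
    have h1 := congrFun h i
    have h2 := congrFun h (i + 1)
    simp only [D, Finset.sum_range_succ] at h1 h2
    have : μ.rowLen i = ν.rowLen i := by omega
    rw [YoungDiagram.mem_cells, YoungDiagram.mem_cells, YoungDiagram.mem_iff_lt_rowLen,
      YoungDiagram.mem_iff_lt_rowLen, this]
  obtain ⟨_, hmem, hmax⟩ := (c.support.image D).exists_maximal (hsupp.image D)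
  obtain ⟨ν, hν, rfl⟩ := Finset.mem_image.1 hmem
  have hcoef := congrFun hc (shapeWeight ν)
  have hexp : (Finsupp.linearCombination ℚ schur c : MvPowerSeries ℕ ℚ) (shapeWeight ν)
      = ∑ μ ∈ c.support, c μ * schur μ (shapeWeight ν) := by
    rw [Finsupp.linearCombination_apply, Finsupp.sum]
    exact Finset.sum_apply (shapeWeight ν) _ _
  rw [hexp, Finset.sum_eq_single ν] at hcoef
  · have hpos : schur ν (shapeWeight ν) ≠ 0 := by
      have := finite_tableaux (μ := ν) (shapeWeight ν)
      have : Nonempty {T : SemistandardYoungTableau ν // tableauWeight T = shapeWeight ν} :=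
        ⟨⟨SemistandardYoungTableau.highestWeight ν, rfl⟩⟩
      have : Nat.card {T : SemistandardYoungTableau ν // tableauWeight T = shapeWeight ν} ≠ 0 :=
        Nat.card_pos.ne'
      exact Nat.cast_ne_zero.2 this
    exact (mul_ne_zero (Finsupp.mem_support_iff.1 hν) hpos) hcoef
  · intro μ hμ hμν
    have hempty : IsEmpty {T : SemistandardYoungTableau μ // tableauWeight T = shapeWeight ν} := by
      refine ⟨fun T => hμν (hD ?_)⟩
      have hle : D ν ≤ D μ := fun n => dominance T.1 T.2 n
      exact le_antisymm (hmax (Finset.mem_image_of_mem D hμ) hle) hle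
    have : schur μ (shapeWeight ν) = 0 := by
      show ((Nat.card {T : SemistandardYoungTableau μ // tableauWeight T = shapeWeight ν} : ℕ) : ℚ)
        = 0
      rw [Nat.card_of_isEmpty, Nat.cast_zero]
    rw [this, mul_zero]
  · intro h
    exact absurd hν h

/-- The space of symmetric functions, as the span of the Schur functions. -/
def Sym : Submodule ℚ (MvPowerSeries ℕ ℚ) := Submodule.span ℚ (Set.range schur)

open Classical in
/-- `[s_μ] f`: the coefficient of `s_μ` in the expansion of the symmetric function `f` in the
Schur basis (by convention `0` if `f` is not a symmetric function). -/
def schurCoeff (μ : YoungDiagram) (f : MvPowerSeries ℕ ℚ) : ℚ :=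
  if h : f ∈ Sym then linearIndependent_schur.repr ⟨f, h⟩ μ else 0

/-- `f` is a symmetric function all of whose Schur coefficients are non-negative. -/
def SchurPositive (f : MvPowerSeries ℕ ℚ) : Prop :=
  f ∈ Sym ∧ ∀ μ : YoungDiagram, 0 ≤ schurCoeff μ f

/-- If `f = ∑ μ, c μ • s_μ`, then `[s_μ] f = c μ`. -/
theorem schurCoeff_linearCombination (c : YoungDiagram →₀ ℚ) (μ : YoungDiagram) :
    schurCoeff μ (Finsupp.linearCombination ℚ schur c) = c μ := by
  have h : Finsupp.linearCombination ℚ schur c ∈ Sym := by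
    rw [Sym, ← Finsupp.range_linearCombination]
    exact ⟨c, rfl⟩
  rw [schurCoeff, dif_pos h, linearIndependent_schur.repr_eq rfl]

/-! ### Chromatic symmetric functions -/

/-- The chromatic symmetric function of a finite graph: the sum over all proper colourings `c` of
the monomials `∏ v, x_{c v}`. -/
def chromSym {V : Type*} [Fintype V] (G : SimpleGraph V) : MvPowerSeries ℕ ℚ :=
  genSeries (fun c : G.Coloring ℕ => ∑ v, Finsupp.single (c v) 1)

theorem finite_colorings {V : Type*} [Fintype V] (G : SimpleGraph V) (m : ℕ →₀ ℕ) :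
    Finite {c : G.Coloring ℕ // (∑ v, Finsupp.single (c v) 1 : ℕ →₀ ℕ) = m} := by
  classical
  let f : {c : G.Coloring ℕ // (∑ v, Finsupp.single (c v) 1 : ℕ →₀ ℕ) = m} → (V → m.support) :=
    fun c v => ⟨c.1 v, by
      rw [Finsupp.mem_support_iff]
      intro h
      have h' := (DFunLike.congr_fun c.2 (c.1 v)).trans h
      rw [Finsupp.finsetSum_apply] at h'
      have := (Finset.sum_eq_zero_iff.1 h') v (Finset.mem_univ v)
      simp at this⟩
  refine Finite.of_injective f ?_
  intro c d h
  apply Subtype.ext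
  apply RelHom.ext
  intro v
  exact congrArg Subtype.val (congrFun h v)

/-! ### Incomparability graphs and spanning non-increasing sequences -/

/-- The incomparability graph of a poset. -/
def incGraph (P : Type*) [PartialOrder P] : SimpleGraph P where
  Adj x y := ¬ x ≤ y ∧ ¬ y ≤ x
  symm := ⟨fun _ _ h => ⟨h.2, h.1⟩⟩
  loopless := ⟨fun _ h => h.1 le_rfl⟩

/-- A spanning non-increasing sequence of the incomparability graph of `P`: a sequence
`(v₁, …, v_k)` containing every element of `P` exactly once, with `v_i ≰ v_{i+1}` for all `i`. -/
def IsSpanningNonIncreasing {P : Type*} [PartialOrder P] (s : List P) : Prop :=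
  (s.Nodup ∧ ∀ v : P, v ∈ s) ∧ s.IsChain (fun v w => ¬ v ≤ w)

/-- The number of spanning non-increasing sequences of the incomparability graph of `P`. -/
def numSpanningNonIncreasing (P : Type*) [PartialOrder P] : ℕ :=
  Nat.card {s : List P // IsSpanningNonIncreasing s}

/-! ### Complete multipartite graphs -/

/-- The poset which is the disjoint union of chains of lengths `l₁, …, l_k` (elements of different
chains are incomparable). -/
abbrev Chains (l : List ℕ) : Type := Σ i : Fin l.length, Fin (l.get i)

/-- The complete multipartite graph `K_l` with stable sets of sizes `l₁, …, l_k`. -/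
def K (l : List ℕ) : SimpleGraph (Chains l) :=
  SimpleGraph.completeMultipartiteGraph (fun i : Fin l.length => Fin (l.get i))

/-- `K_l` is the incomparability graph of the disjoint union of chains of lengths `l₁, …, l_k`. -/
theorem K_eq_incGraph (l : List ℕ) : K l = incGraph (Chains l) := by
  ext ⟨i, a⟩ ⟨j, b⟩
  constructor
  · intro h
    have hij : i ≠ j := h
    constructor
    · intro hle
      obtain ⟨e, _⟩ := Sigma.le_def.1 hle
      exact hij e
    · intro hle
      obtain ⟨e, _⟩ := Sigma.le_def.1 hle
      exact hij e.symm
  · rintro ⟨h1, h2⟩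
    show i ≠ j
    rintro rfl
    rcases le_total a b with h | h
    · exact h1 (Sigma.mk_le_mk_iff.2 h)
    · exact h2 (Sigma.mk_le_mk_iff.2 h)

/-- `N_sp(K_l)`, where `K_l` is viewed as the incomparability graph of the disjoint union of
chains of lengths `l₁, …, l_k`. -/
def Nsp (l : List ℕ) : ℕ := numSpanningNonIncreasing (Chains l)

/-- The list `3^a, 2^b, 1^c`. -/
def list321 (a b c : ℕ) : List ℕ :=
  List.replicate a 3 ++ (List.replicate b 2 ++ List.replicate c 1)

theorem list321_sorted (a b c : ℕ) : (list321 a b c).SortedGE := by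
  apply List.Pairwise.sortedGE
  rw [list321, List.pairwise_append, List.pairwise_append]
  simp only [List.pairwise_replicate, List.mem_replicate, List.mem_append]
  refine ⟨by simp, ⟨by simp, by simp, ?_⟩, ?_⟩
  · rintro x ⟨_, rfl⟩ y ⟨_, rfl⟩
    norm_num
  · rintro x ⟨_, rfl⟩ y (⟨_, rfl⟩ | ⟨_, rfl⟩) <;> norm_num

/-- The Young diagram of the partition `(3^a, 2^b, 1^c)`. -/
def shape321 (a b c : ℕ) : YoungDiagram :=
  YoungDiagram.ofRowLens (list321 a b c) (list321_sorted a b c)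

/-- The complete multipartite graph `K_{(3^a, 2^b, 1^c)}`. -/
abbrev K321 (a b c : ℕ) : SimpleGraph (Chains (list321 a b c)) := K (list321 a b c)

/-- `N_sp(K_{(3^a, 2^b, 1^c)})`. -/
def Nsp321 (a b c : ℕ) : ℕ := Nsp (list321 a b c)

end ChromSchur

end

namespace ChromSchur

open Finset

/-! Let `f` be symmetric and homogeneous of degree `n`, with all exponents of its monomials at most
three. Its coefficient at a monomial of type `λ` can be recorded as `L(e_λ)`, where `L` is a linear
functional on `ℚ[e₁, e₂, e₃]`. Since `e_λ = ∑ K_{μλ} s_{μ'}`, while `K_{μλ}` is also the coefficient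
of `x^λ` in `s_μ`, it follows that `f = ∑ L(s_{μ'}) s_μ`. So Schur coefficients are values of `L` at
Schur polynomials in three variables, indexed by column lengths (`sum_kostka_schurDet`,
`eq_linearCombination_schur`).

The colour classes of a proper colouring of a complete multipartite graph lie inside the parts.
Peeling off one part at a time counts the colourings of each type in closed form
(`colorCount_replicate_two`, `colorCount_three_twos`). For `(3, 2^β)` at most one class has three
elements, so `L` kills multiples of `e₃²` and Schur polynomials are needed only modulo `e₃²`. Each
row `r` of the index contributes a factor `e₃`: two such factors give coefficient `0`, one reduces
to the graph `K_{(2^β)}`, and for two-row shapes the Pieri rules give the constant and linear terms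
in `e₃` (`schurDet_mod_sq`).

Applying `L` turns these expansions into sums `∑ (-1)^k C(M, k) (s - k)!`. By inclusion and
exclusion such a sum (`avoidCount`) counts the orderings of `s` objects avoiding `M` disjoint
successions, which is how `N_sp` enters (`Nsp321_twos`, `Nsp321_three`). The only negative term,
`N_sp(2^N)`, is outweighed because a sequence stays admissible when an isolated point is put in
front of it, so `N_sp(2^N) ≤ N_sp(2^N, 1)`. -/

/-! ### Branching of semistandard tableaux -/

/-- The Kostka number: the number of semistandard tableaux of shape `μ` and weight `m`. -/
noncomputable def kostka (μ : YoungDiagram) (m : ℕ →₀ ℕ) : ℕ :=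
  Nat.card {T : SemistandardYoungTableau μ // tableauWeight T = m}

/-- The skew shape `μ / ν` is a horizontal strip. -/
def IsHorizontalStrip (ν μ : YoungDiagram) : Prop :=
  ν ≤ μ ∧ ∀ i j, (i + 1, j) ∈ μ → (i, j) ∈ ν

/-- The shape formed by the cells of `T` with entry less than `N`. -/
def below {μ : YoungDiagram} (T : SemistandardYoungTableau μ) (N : ℕ) : YoungDiagram where
  cells := μ.cells.filter (fun c => T c.1 c.2 < N)
  isLowerSet := by
    rintro ⟨i, j⟩ ⟨i', j'⟩ hle h
    simp only [coe_filter, Set.mem_ofPred_eq, YoungDiagram.mem_cells] at h ⊢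
    obtain ⟨h1, h2⟩ := Prod.mk_le_mk.1 hle
    refine ⟨μ.up_left_mem h1 h2 h.1, ?_⟩
    calc T i' j' ≤ T i' j := T.row_weak_of_le h2 (μ.up_left_mem h1 le_rfl h.1)
      _ ≤ T i j := T.col_weak h1 h.1
      _ < N := h.2

theorem mem_below {μ : YoungDiagram} {T : SemistandardYoungTableau μ} {N : ℕ} {i j : ℕ} :
    (i, j) ∈ below T N ↔ (i, j) ∈ μ ∧ T i j < N := by
  rw [← YoungDiagram.mem_cells, below, mem_filter, YoungDiagram.mem_cells]

/-- Restriction of a tableau to a smaller shape. -/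
def restrictTo {μ : YoungDiagram} (T : SemistandardYoungTableau μ) (ν : YoungDiagram)
    (h : ν ≤ μ) : SemistandardYoungTableau ν where
  entry i j := if (i, j) ∈ ν then T i j else 0
  row_weak' {i j1 j2} hj hm := by
    rw [if_pos hm, if_pos (ν.up_left_mem le_rfl hj.le hm)]
    exact T.row_weak hj (h hm)
  col_strict' {i1 i2 j} hi hm := by
    rw [if_pos hm, if_pos (ν.up_left_mem hi.le le_rfl hm)]
    exact T.col_strict hi (h hm)
  zeros' h := if_neg h

theorem restrictTo_apply {μ : YoungDiagram} (T : SemistandardYoungTableau μ) (ν : YoungDiagram)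
    (h : ν ≤ μ) (i j : ℕ) : restrictTo T ν h i j = if (i, j) ∈ ν then T i j else 0 := rfl

/-- Extension of a tableau along a horizontal strip, whose cells are filled with `N`. -/
def extendBy {μ ν : YoungDiagram} (T : SemistandardYoungTableau ν) (h : IsHorizontalStrip ν μ)
    (N : ℕ) (hT : ∀ i j, (i, j) ∈ ν → T i j < N) : SemistandardYoungTableau μ where
  entry i j := if (i, j) ∈ ν then T i j else if (i, j) ∈ μ then N else 0
  row_weak' {i j1 j2} hj hm := by
    by_cases h2 : (i, j2) ∈ ν
    · rw [if_pos h2, if_pos (ν.up_left_mem le_rfl hj.le h2)]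
      exact T.row_weak hj h2
    · rw [if_neg h2, if_pos hm]
      split_ifs with h3
      · exact (hT _ _ h3).le
      · exact le_rfl
      · exact Nat.zero_le _
  col_strict' {i1 i2 j} hi hm := by
    have h1 : (i1, j) ∈ ν := h.2 _ _ (μ.up_left_mem hi le_rfl hm)
    rw [if_pos h1]
    by_cases h2 : (i2, j) ∈ ν
    · rw [if_pos h2]
      exact T.col_strict hi h2
    · rw [if_neg h2, if_pos hm]
      exact hT _ _ h1
  zeros' hm := by
    rw [if_neg (fun h' => hm (h.1 h')), if_neg hm]

theorem extendBy_apply {μ ν : YoungDiagram} (T : SemistandardYoungTableau ν)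
    (h : IsHorizontalStrip ν μ) (N : ℕ) (hT : ∀ i j, (i, j) ∈ ν → T i j < N) (i j : ℕ) :
    extendBy T h N hT i j = if (i, j) ∈ ν then T i j else if (i, j) ∈ μ then N else 0 := rfl

theorem weight_entry_ne_zero {μ : YoungDiagram} (T : SemistandardYoungTableau μ) {i j : ℕ}
    (h : (i, j) ∈ μ) : tableauWeight T (T i j) ≠ 0 := by
  rw [tableauWeight_apply]
  exact card_ne_zero_of_mem (mem_filter.2 ⟨h, rfl⟩)

theorem entry_le_of_weight {μ : YoungDiagram} {T : SemistandardYoungTableau μ} {M : ℕ →₀ ℕ}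
    (hT : tableauWeight T = M) {N : ℕ} (hM : ∀ k, N < k → M k = 0) {i j : ℕ}
    (h : (i, j) ∈ μ) : T i j ≤ N := by
  by_contra hc
  exact weight_entry_ne_zero T h (by rw [hT]; exact hM _ (by omega))

theorem entry_lt_of_weight {μ : YoungDiagram} {T : SemistandardYoungTableau μ} {M : ℕ →₀ ℕ}
    {N : ℕ} (hT : tableauWeight T = M.erase N) (hM : ∀ k, N < k → M k = 0) {i j : ℕ}
    (h : (i, j) ∈ μ) : T i j < N := by
  by_contra hc
  refine weight_entry_ne_zero T h ?_
  rw [hT, Finsupp.erase_apply]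
  split_ifs with he
  · rfl
  · exact hM _ (by omega)

/-- Columns are strict, so the cell above any cell has entry less than the maximum `N`. -/
theorem below_isHorizontalStrip {μ : YoungDiagram} {T : SemistandardYoungTableau μ} {N : ℕ}
    (h : ∀ i j, (i, j) ∈ μ → T i j ≤ N) : IsHorizontalStrip (below T N) μ := by
  refine ⟨fun c hc => ?_, fun i j hm => ?_⟩
  · obtain ⟨i, j⟩ := c
    exact (mem_below.1 hc).1
  · refine mem_below.2 ⟨μ.up_left_mem (Nat.le_succ i) le_rfl hm, ?_⟩
    exact lt_of_lt_of_le (T.col_strict (Nat.lt_succ_self i) hm) (h _ _ hm)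

theorem card_below_add {μ : YoungDiagram} {T : SemistandardYoungTableau μ} {N : ℕ}
    (h : ∀ i j, (i, j) ∈ μ → T i j ≤ N) :
    (below T N).card + tableauWeight T N = μ.card := by
  rw [tableauWeight_apply]
  show (μ.cells.filter _).card + _ = μ.cells.card
  rw [← card_filter_add_card_filter_not (s := μ.cells) (fun c => T c.1 c.2 < N)]
  congr 2
  apply filter_congr
  rintro ⟨i, j⟩ hc
  have := h i j hc
  simp only
  omega

theorem tableauWeight_restrictTo_below {μ : YoungDiagram} {T : SemistandardYoungTableau μ}
    {M : ℕ →₀ ℕ} (hT : tableauWeight T = M) {N : ℕ} (hM : ∀ k, N < k → M k = 0)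
    {ν : YoungDiagram} (hν : below T N = ν) (hle : ν ≤ μ) :
    tableauWeight (restrictTo T ν hle) = M.erase N := by
  subst hν
  ext k
  rw [tableauWeight_apply, Finsupp.erase_apply]
  rcases lt_or_ge k N with hk | hk
  · rw [if_neg hk.ne, ← hT, tableauWeight_apply]
    congr 1
    ext ⟨i, j⟩
    rw [mem_filter, mem_filter, YoungDiagram.mem_cells, YoungDiagram.mem_cells,
      restrictTo_apply]
    constructor
    · rintro ⟨h1, h2⟩
      rw [if_pos h1] at h2
      exact ⟨(mem_below.1 h1).1, h2⟩
    · rintro ⟨h1, h2⟩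
      have h3 : T i j = k := h2
      have : (i, j) ∈ below T N := mem_below.2 ⟨h1, by omega⟩
      exact ⟨this, by rw [if_pos this, h2]⟩
  · have : (filter (fun c : ℕ × ℕ => restrictTo T (below T N) hle c.1 c.2 = k)
        (below T N).cells) = ∅ := by
      apply filter_eq_empty_iff.2
      rintro ⟨i, j⟩ h1 h2
      have h1' : (i, j) ∈ below T N := h1
      rw [restrictTo_apply, if_pos h1'] at h2
      have : T i j < N := (mem_below.1 h1').2
      have h3 : T i j = k := h2
      omega
    rw [this, card_empty]
    split_ifs with he
    · rfl
    · exact (hM k (by omega)).symm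

theorem tableauWeight_extendBy {μ ν : YoungDiagram} {T : SemistandardYoungTableau ν}
    (h : IsHorizontalStrip ν μ) {N : ℕ} (hT : ∀ i j, (i, j) ∈ ν → T i j < N) {M : ℕ →₀ ℕ}
    (hw : tableauWeight T = M.erase N) (hc : ν.card + M N = μ.card) :
    tableauWeight (extendBy T h N hT) = M := by
  ext k
  rw [tableauWeight_apply]
  have hsub : ν.cells ⊆ μ.cells := h.1
  have hsplit : μ.cells.filter (fun c => extendBy T h N hT c.1 c.2 = k) =
      ν.cells.filter (fun c => T c.1 c.2 = k) ∪
        (μ.cells \ ν.cells).filter (fun _ => N = k) := by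
    ext ⟨i, j⟩
    simp only [mem_filter, mem_union, mem_sdiff, extendBy_apply, YoungDiagram.mem_cells]
    by_cases h1 : (i, j) ∈ ν
    · have h2 : (i, j) ∈ μ := h.1 h1
      simp [h1, h2]
    · by_cases h2 : (i, j) ∈ μ <;> simp [h1, h2]
  rw [hsplit, card_union_of_disjoint, ← tableauWeight_apply, hw, Finsupp.erase_apply]
  · by_cases hk : N = k
    · subst hk
      rw [if_pos rfl, filter_true_of_mem (fun _ _ => rfl), card_sdiff_of_subset hsub]
      have hc' : ν.cells.card + M N = μ.cells.card := hc
      omega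
    · rw [if_neg (Ne.symm hk), filter_false_of_mem (fun _ _ => hk), card_empty, add_zero]
  · refine disjoint_left.2 fun c h1 h2 => ?_
    exact (mem_sdiff.1 (mem_filter.1 h2).1).2 (mem_filter.1 h1).1

theorem below_extendBy {μ ν : YoungDiagram} {T : SemistandardYoungTableau ν}
    (h : IsHorizontalStrip ν μ) {N : ℕ} (hT : ∀ i j, (i, j) ∈ ν → T i j < N) :
    below (extendBy T h N hT) N = ν := by
  ext ⟨i, j⟩
  rw [YoungDiagram.mem_cells, YoungDiagram.mem_cells, mem_below, extendBy_apply]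
  by_cases h1 : (i, j) ∈ ν
  · simp [h1, h.1 h1, hT _ _ h1]
  · simp +contextual [h1]

/-- Tableaux of weight `M` whose entries less than `N` form the shape `ν`, where `μ / ν` is a
horizontal strip, correspond to tableaux of shape `ν`. -/
def fiberEquiv {μ ν : YoungDiagram} {M : ℕ →₀ ℕ} {N : ℕ} (hM : ∀ k, N < k → M k = 0)
    (h : IsHorizontalStrip ν μ) (hc : ν.card + M N = μ.card) :
    {T : {T : SemistandardYoungTableau μ // tableauWeight T = M} // below T.1 N = ν} ≃
      {T : SemistandardYoungTableau ν // tableauWeight T = M.erase N} where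
  toFun T := ⟨restrictTo T.1.1 ν h.1, tableauWeight_restrictTo_below T.1.2 hM T.2 h.1⟩
  invFun T := ⟨⟨extendBy T.1 h N (fun _ _ hm => entry_lt_of_weight T.2 hM hm),
    tableauWeight_extendBy h _ T.2 hc⟩,
      below_extendBy h (fun _ _ hm => entry_lt_of_weight T.2 hM hm)⟩
  left_inv T := by
    obtain ⟨⟨T, hT⟩, rfl⟩ := T
    apply Subtype.ext
    apply Subtype.ext
    apply SemistandardYoungTableau.ext
    intro i j
    simp only [extendBy_apply, restrictTo_apply]
    split_ifs with h1 h2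
    · rfl
    · have h3 := entry_le_of_weight hT hM h2
      have h4 : ¬ T i j < N := fun h' => h1 (mem_below.2 ⟨h2, h'⟩)
      omega
    · exact (T.zeros h2).symm
  right_inv T := by
    apply Subtype.ext
    apply SemistandardYoungTableau.ext
    intro i j
    simp only [extendBy_apply, restrictTo_apply]
    split_ifs with h1
    · rfl
    · exact (T.1.zeros h1).symm

/-- Branching rule: removing the entries equal to the largest letter. -/
theorem kostka_branching {μ : YoungDiagram} {M : ℕ →₀ ℕ} {N : ℕ} (hM : ∀ k, N < k → M k = 0)
    (F : Finset YoungDiagram)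
    (hF : ∀ ν, ν ∈ F ↔ IsHorizontalStrip ν μ ∧ ν.card + M N = μ.card) :
    kostka μ M = ∑ ν ∈ F, kostka ν (M.erase N) := by
  have hmem : ∀ T : {T : SemistandardYoungTableau μ // tableauWeight T = M},
      below T.1 N ∈ F := fun T => by
    have hle : ∀ i j, (i, j) ∈ μ → T.1 i j ≤ N := fun _ _ hm => entry_le_of_weight T.2 hM hm
    refine (hF _).2 ⟨below_isHorizontalStrip hle, ?_⟩
    rw [← card_below_add hle, T.2]
  let f : {T : SemistandardYoungTableau μ // tableauWeight T = M} → F := fun T => ⟨_, hmem T⟩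
  have hfin := finite_tableaux (μ := μ) M
  rw [kostka, Nat.card_congr (Equiv.sigmaFiberEquiv f).symm, Nat.card_sigma]
  rw [← Finset.sum_coe_sort F]
  refine Fintype.sum_congr _ _ fun ν => ?_
  obtain ⟨h1, h2⟩ := (hF ν.1).1 ν.2
  rw [kostka, ← Nat.card_congr (fiberEquiv hM h1 h2)]
  exact Nat.card_congr (Equiv.subtypeEquivRight fun T => Subtype.ext_iff)

theorem kostka_eq_zero_of_degree {μ : YoungDiagram} {m : ℕ →₀ ℕ} (h : m.degree ≠ μ.card) :
    kostka μ m = 0 := by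
  rw [kostka, Nat.card_eq_zero]
  left
  refine ⟨fun T => h ?_⟩
  rw [← T.2, tableauWeight, map_sum]
  simp [YoungDiagram.card]

/-! ### Diagrams with at most three columns -/

/-- The diagram with columns of lengths `p ≥ q ≥ r`. -/
def threeCol (p q r : ℕ) : YoungDiagram where
  cells := (range p ×ˢ range 3).filter
    (fun c => (c.2 = 1 → c.1 < q) ∧ (c.2 = 2 → c.1 < r ∧ c.1 < q))
  isLowerSet := by
    rintro ⟨i, j⟩ ⟨i', j'⟩ hle h
    obtain ⟨h1, h2⟩ := Prod.mk_le_mk.1 hle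
    simp only [coe_filter, Set.mem_ofPred_eq, mem_product, mem_range] at h ⊢
    omega

theorem mem_threeCol {p q r i j : ℕ} : (i, j) ∈ threeCol p q r ↔
    (i < p ∧ j < 3) ∧ (j = 1 → i < q) ∧ (j = 2 → i < r ∧ i < q) := by
  rw [← YoungDiagram.mem_cells, threeCol]
  simp only [mem_filter, mem_product, mem_range]

theorem card_threeCol {p q r : ℕ} (hpq : q ≤ p) (hqr : r ≤ q) :
    (threeCol p q r).card = p + q + r := by
  have : (threeCol p q r).cells = range p ×ˢ {0} ∪ (range q ×ˢ {1} ∪ range r ×ˢ {2}) := by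
    ext ⟨i, j⟩
    rw [YoungDiagram.mem_cells, mem_threeCol]
    simp only [mem_union, mem_product, mem_range, mem_singleton]
    omega
  rw [YoungDiagram.card, this, card_union_of_disjoint, card_union_of_disjoint]
  · simp [add_assoc]
  · refine disjoint_left.2 ?_
    rintro ⟨i, j⟩
    simp only [mem_product, mem_range, mem_singleton]
    omega
  · refine disjoint_left.2 ?_
    rintro ⟨i, j⟩
    simp only [mem_union, mem_product, mem_range, mem_singleton]
    omega

/-- Triples of column lengths of partitions of `n` with at most three columns. -/
def shapes (n : ℕ) : Finset (ℕ × ℕ × ℕ) :=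
  (range (n + 1) ×ˢ range (n + 1) ×ˢ range (n + 1)).filter
    (fun t => t.2.1 ≤ t.1 ∧ t.2.2 ≤ t.2.1 ∧ t.1 + t.2.1 + t.2.2 = n)

theorem mem_shapes {n : ℕ} {t : ℕ × ℕ × ℕ} :
    t ∈ shapes n ↔ t.2.1 ≤ t.1 ∧ t.2.2 ≤ t.2.1 ∧ t.1 + t.2.1 + t.2.2 = n := by
  simp only [shapes, mem_filter, mem_product, mem_range]
  omega

/-- The diagram of a triple of column lengths. -/
def diagram (t : ℕ × ℕ × ℕ) : YoungDiagram := threeCol t.1 t.2.1 t.2.2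

theorem card_diagram {n : ℕ} {t : ℕ × ℕ × ℕ} (ht : t ∈ shapes n) : (diagram t).card = n := by
  obtain ⟨h1, h2, h3⟩ := mem_shapes.1 ht
  rw [diagram, card_threeCol h1 h2, h3]

theorem diagram_le_iff {n n' : ℕ} {t s : ℕ × ℕ × ℕ} (ht : t ∈ shapes n) (hs : s ∈ shapes n') :
    diagram s ≤ diagram t ↔ s.1 ≤ t.1 ∧ s.2.1 ≤ t.2.1 ∧ s.2.2 ≤ t.2.2 := by
  obtain ⟨h1, h2, -⟩ := mem_shapes.1 ht
  obtain ⟨h1', h2', -⟩ := mem_shapes.1 hs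
  constructor
  · intro h
    refine ⟨?_, ?_, ?_⟩ <;> by_contra hc
    · have := mem_threeCol.1 (h (x := (t.1, 0)) (mem_threeCol.2 (by omega)))
      omega
    · have := mem_threeCol.1 (h (x := (t.2.1, 1)) (mem_threeCol.2 (by omega)))
      omega
    · have := mem_threeCol.1 (h (x := (t.2.2, 2)) (mem_threeCol.2 (by omega)))
      omega
  · rintro h ⟨i, j⟩ hm
    have := mem_threeCol.1 hm
    exact mem_threeCol.2 (by omega)

theorem diagram_injOn (n : ℕ) : Set.InjOn diagram (shapes n) := by
  intro s hs t ht h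
  have h1 := (diagram_le_iff ht hs).1 h.le
  have h2 := (diagram_le_iff hs ht).1 h.ge
  ext <;> omega

/-- `s` is obtained from `t` by shortening each column by at most one cell. -/
def StepLE (s t : ℕ × ℕ × ℕ) : Prop :=
  (s.1 ≤ t.1 ∧ t.1 ≤ s.1 + 1) ∧ (s.2.1 ≤ t.2.1 ∧ t.2.1 ≤ s.2.1 + 1) ∧
    (s.2.2 ≤ t.2.2 ∧ t.2.2 ≤ s.2.2 + 1)

instance (s t : ℕ × ℕ × ℕ) : Decidable (StepLE s t) := by unfold StepLE; infer_instance

/-- A horizontal strip has at most one cell in each column, so it becomes a condition on each column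
length separately. -/
theorem isHorizontalStrip_diagram_iff {n n' : ℕ} {t s : ℕ × ℕ × ℕ} (ht : t ∈ shapes n)
    (hs : s ∈ shapes n') : IsHorizontalStrip (diagram s) (diagram t) ↔ StepLE s t := by
  rw [IsHorizontalStrip, diagram_le_iff ht hs]
  obtain ⟨h1, h2, -⟩ := mem_shapes.1 ht
  obtain ⟨h1', h2', -⟩ := mem_shapes.1 hs
  constructor
  · rintro ⟨h, h'⟩
    have h'' : ∀ i j, (i + 1, j) ∈ threeCol t.1 t.2.1 t.2.2 →
      (i, j) ∈ threeCol s.1 s.2.1 s.2.2 := h'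
    simp only [mem_threeCol] at h''
    -- The first cell missing from each column of `s`: if the column of `t` reached one cell further
    -- still, that missing cell would have to lie in `s`.
    have a := h'' s.1 0
    have b := h'' s.2.1 1
    have c := h'' s.2.2 2
    unfold StepLE
    omega
  · rintro h
    unfold StepLE at h
    refine ⟨by omega, fun i j hm => ?_⟩
    have := mem_threeCol.1 hm
    exact mem_threeCol.2 (by omega)

theorem exists_diagram_of_le {t : ℕ × ℕ × ℕ} {ν : YoungDiagram} (h : ν ≤ diagram t) :
    ∃ s ∈ shapes ν.card, diagram s = ν := by
  have key : diagram (ν.colLen 0, ν.colLen 1, ν.colLen 2) = ν := by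
    ext ⟨i, j⟩
    rw [YoungDiagram.mem_cells, YoungDiagram.mem_cells, diagram, mem_threeCol]
    dsimp only
    have h01 := ν.colLen_anti 0 1 (by omega)
    have h12 := ν.colLen_anti 1 2 (by omega)
    constructor
    · rintro ⟨⟨h1, h2⟩, h3, h4⟩
      rw [YoungDiagram.mem_iff_lt_colLen]
      interval_cases j <;> omega
    · intro hm
      have h3 := (mem_threeCol.1 (h hm)).1.2
      rw [YoungDiagram.mem_iff_lt_colLen] at hm
      interval_cases j <;> omega
  have h01 := ν.colLen_anti 0 1 (by omega)
  have h12 := ν.colLen_anti 1 2 (by omega)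
  refine ⟨(ν.colLen 0, ν.colLen 1, ν.colLen 2), mem_shapes.2 ⟨h01, h12, ?_⟩, key⟩
  have := card_threeCol h01 h12
  rw [← this]
  exact congrArg YoungDiagram.card key

theorem kostka_diagram_branching {n v : ℕ} {t : ℕ × ℕ × ℕ} (ht : t ∈ shapes (n + v))
    {M : ℕ →₀ ℕ} {N : ℕ} (hM : ∀ k, N < k → M k = 0) (hv : M N = v) :
    kostka (diagram t) M =
      ∑ s ∈ (shapes n).filter (fun s => StepLE s t), kostka (diagram s) (M.erase N) := by
  classical
  rw [kostka_branching hM (((shapes n).filter (fun s => StepLE s t)).image diagram),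
    sum_image]
  · intro a ha b hb
    exact diagram_injOn n (mem_filter.1 ha).1 (mem_filter.1 hb).1
  · intro ν
    rw [mem_image, card_diagram ht, hv]
    constructor
    · rintro ⟨s, hs, rfl⟩
      obtain ⟨h1, h2⟩ := mem_filter.1 hs
      exact ⟨(isHorizontalStrip_diagram_iff ht h1).2 h2, by rw [card_diagram h1]⟩
    · rintro ⟨h1, h2⟩
      obtain ⟨s, hs, rfl⟩ := exists_diagram_of_le h1.1
      have : (diagram s).card = n := by omega
      rw [this] at hs
      exact ⟨s, mem_filter.2 ⟨hs, (isHorizontalStrip_diagram_iff ht hs).1 h1⟩, rfl⟩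

/-! ### Three-row determinants in complete symmetric functions -/

section Determinant

variable {R : Type*} [CommRing R] (e₁ e₂ e₃ : R)

/-- The elementary symmetric functions of three variables. -/
def elem : ℕ → R
  | 0 => 1
  | 1 => e₁
  | 2 => e₂
  | 3 => e₃
  | _ => 0

/-- The complete symmetric functions of three variables, shifted by two: `complete (n + 2)` has
degree `n`. -/
def complete : ℕ → R
  | 0 => 0
  | 1 => 0
  | 2 => 1
  | n + 3 => e₁ * complete (n + 2) - e₂ * complete (n + 1) + e₃ * complete n

theorem complete_add_three (n : ℕ) : complete e₁ e₂ e₃ (n + 1 + 1 + 1) =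
    e₁ * complete e₁ e₂ e₃ (n + 1 + 1) - e₂ * complete e₁ e₂ e₃ (n + 1)
      + e₃ * complete e₁ e₂ e₃ n := by
  rw [complete]

/-- The determinant with rows `(h x, h (x + 1), h (x + 2))`, and similarly for `y` and `z`. -/
def detThree (x y z : ℕ) : R :=
  let h := complete e₁ e₂ e₃
  h x * (h (y + 1) * h (z + 1 + 1) - h (y + 1 + 1) * h (z + 1))
    - h (x + 1) * (h y * h (z + 1 + 1) - h (y + 1 + 1) * h z)
    + h (x + 1 + 1) * (h y * h (z + 1) - h (y + 1) * h z)

theorem detThree_self_left (x z : ℕ) : detThree e₁ e₂ e₃ x x z = 0 := by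
  simp only [detThree]; ring

theorem detThree_self_right (x y : ℕ) : detThree e₁ e₂ e₃ x y y = 0 := by
  simp only [detThree]; ring

/-- Shifting an index by one multiplies the row vector by the companion matrix of `X³ - e₁X² + e₂X -
e₃`. Summing the determinant over shifts of one, two or three rows therefore multiplies it by the
corresponding coefficient of the characteristic polynomial. This is the Pieri rule for `e₁`; the
next two lemmas treat `e₂` and `e₃`. -/
theorem detThree_pieri_one (x y z : ℕ) :
    detThree e₁ e₂ e₃ (x + 1) y z + detThree e₁ e₂ e₃ x (y + 1) z
      + detThree e₁ e₂ e₃ x y (z + 1) = e₁ * detThree e₁ e₂ e₃ x y z := by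
  simp only [detThree, complete_add_three]; ring

theorem detThree_pieri_two (x y z : ℕ) :
    detThree e₁ e₂ e₃ (x + 1) (y + 1) z + detThree e₁ e₂ e₃ (x + 1) y (z + 1)
      + detThree e₁ e₂ e₃ x (y + 1) (z + 1) = e₂ * detThree e₁ e₂ e₃ x y z := by
  simp only [detThree, complete_add_three]; ring

theorem detThree_pieri_three (x y z : ℕ) :
    detThree e₁ e₂ e₃ (x + 1) (y + 1) (z + 1) = e₃ * detThree e₁ e₂ e₃ x y z := by
  simp only [detThree, complete_add_three]; ring

/-- The Schur polynomial in three variables of the partition `t`, in terms of the elementary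
symmetric functions. -/
def schurDet (t : ℕ × ℕ × ℕ) : R := detThree e₁ e₂ e₃ (t.1 + 2) (t.2.1 + 1) t.2.2

/-- The determinant identities sum over all ways to raise `v` of the three indices. Choices that
fail to give a partition contribute nothing, since the offsets `2, 1, 0` then make two rows of the
determinant equal. -/
theorem schurDet_pieri {n : ℕ} (v : ℕ) {s : ℕ × ℕ × ℕ} (hs : s ∈ shapes n) :
    ∑ t ∈ (shapes (n + v)).filter (fun t => StepLE s t), schurDet e₁ e₂ e₃ t =
      elem e₁ e₂ e₃ v * schurDet e₁ e₂ e₃ s := by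
  classical
  obtain ⟨p, q, r⟩ := s
  obtain ⟨h1, h2, h3⟩ := mem_shapes.1 hs
  simp only at h1 h2 h3
  let B : Finset (ℕ × ℕ × ℕ) := (range 2 ×ˢ range 2 ×ˢ range 2).filter
    (fun ε => ε.1 + ε.2.1 + ε.2.2 = v)
  have hB : ∑ t ∈ (shapes (n + v)).filter (fun t => StepLE (p, q, r) t), schurDet e₁ e₂ e₃ t =
      ∑ ε ∈ B, schurDet e₁ e₂ e₃ (p + ε.1, q + ε.2.1, r + ε.2.2) := by
    rw [← sum_image (f := schurDet e₁ e₂ e₃) (g := fun ε : ℕ × ℕ × ℕ =>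
      (p + ε.1, q + ε.2.1, r + ε.2.2))]
    · apply sum_subset
      · rintro ⟨a, b, c⟩ ht
        obtain ⟨h4, h5⟩ := mem_filter.1 ht
        have h4 := mem_shapes.1 h4
        simp only [StepLE] at h4 h5
        refine mem_image.2 ⟨(a - p, b - q, c - r), ?_, ?_⟩
        · simp only [B, mem_filter, mem_product, mem_range]
          omega
        · ext <;> simp only <;> omega
      · intro t ht hnt
        obtain ⟨⟨a, b, c⟩, hε, rfl⟩ := mem_image.1 ht
        simp only [B, mem_filter, mem_product, mem_range] at hε
        -- Each index moves by at most one, so order can fail only by exactly one, and this is a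
        -- coincidence of two rows.
        have h6 : ¬ (q + b ≤ p + a ∧ r + c ≤ q + b) := by
          intro h6
          refine hnt (mem_filter.2 ⟨mem_shapes.2 ?_, ?_⟩)
          · simp only
            omega
          · simp only [StepLE]
            omega
        simp only [schurDet]
        by_cases h7 : q + b ≤ p + a
        · have : r + c = q + b + 1 := by omega
          rw [this, detThree_self_right]
        · have : p + a + 2 = q + b + 1 := by omega
          rw [this, detThree_self_left]
    · rintro ⟨a, b, c⟩ - ⟨a', b', c'⟩ - h
      simp only [Prod.mk.injEq] at h
      ext <;> simp only <;> omega
  rw [hB]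
  have hB' : B = (range 2 ×ˢ range 2 ×ˢ range 2).filter
    (fun ε => ε.1 + ε.2.1 + ε.2.2 = v) := rfl
  rw [hB', sum_filter, sum_product]
  simp only [sum_product, sum_range_succ, sum_range_zero, zero_add, schurDet]
  match v with
  | 0 => simp [elem]
  | 1 =>
    rw [elem, ← detThree_pieri_one]
    simp only [add_zero, add_right_comm _ 1 _]
    norm_num
    ring
  | 2 =>
    rw [elem, ← detThree_pieri_two]
    simp only [add_zero, add_right_comm _ 1 _]
    norm_num
    ring
  | 3 =>
    rw [elem, ← detThree_pieri_three]
    simp only [add_zero, add_right_comm _ 1 _]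
    norm_num
  | v + 4 =>
    rw [elem]
    · simp
    all_goals omega

/-- The expansion of a product of elementary symmetric functions in Schur functions. Both sides obey
the same recursion in the last letter: branching on the Kostka numbers, and Pieri on the Schur
polynomials. -/
theorem sum_kostka_schurDet (N : ℕ) : ∀ m : ℕ →₀ ℕ, (∀ k, N ≤ k → m k = 0) →
    ∑ t ∈ shapes (∑ i ∈ range N, m i), (kostka (diagram t) m : R) * schurDet e₁ e₂ e₃ t =
      ∏ i ∈ range N, elem e₁ e₂ e₃ (m i) := by
  induction N with
  | zero =>
    intro m hm
    have hm0 : m = 0 := Finsupp.ext fun k => hm k (Nat.zero_le _)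
    subst hm0
    have hs : shapes (∑ i ∈ range 0, (0 : ℕ →₀ ℕ) i) = {(0, 0, 0)} := by
      ext ⟨a, b, c⟩
      rw [mem_shapes]
      simp
      omega
    have hY : ∀ i j, (i, j) ∉ diagram (0, 0, 0) := fun i j h => by
      have := mem_threeCol.1 h
      omega
    have hk : kostka (diagram (0, 0, 0)) 0 = 1 := by
      rw [kostka, Nat.card_eq_one_iff_unique]
      refine ⟨⟨fun S T => ?_⟩, ⟨⟨SemistandardYoungTableau.highestWeight _, ?_⟩⟩⟩
      · apply Subtype.ext
        apply SemistandardYoungTableau.ext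
        intro i j
        rw [S.1.zeros (hY i j), T.1.zeros (hY i j)]
      · ext k
        rw [tableauWeight_apply, Finsupp.zero_apply, card_eq_zero]
        exact filter_eq_empty_iff.2 fun c hc => absurd hc (hY c.1 c.2)
    rw [hs, sum_singleton, hk, prod_range_zero]
    simp [schurDet, detThree, complete]
  | succ N ih =>
    intro M hM
    have hM' : ∀ k, N < k → M k = 0 := fun k hk => hM k hk
    have he : ∀ i ∈ range N, (M.erase N) i = M i := fun i hi => by
      rw [Finsupp.erase_ne (mem_range.1 hi).ne]
    have hih := ih (M.erase N) fun k hk => by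
      rw [Finsupp.erase_apply]
      split_ifs with h
      · rfl
      · exact hM k (by omega)
    rw [sum_congr rfl he, prod_congr rfl fun i hi => by rw [he i hi]] at hih
    rw [prod_range_succ, ← hih, sum_range_succ]
    set n := ∑ i ∈ range N, M i
    have h1 : ∀ t ∈ shapes (n + M N), (kostka (diagram t) M : R) * schurDet e₁ e₂ e₃ t =
        ∑ s ∈ (shapes n).filter (fun s => StepLE s t),
          (kostka (diagram s) (M.erase N) : R) * schurDet e₁ e₂ e₃ t := fun t ht => by
      rw [kostka_diagram_branching ht hM' rfl, Nat.cast_sum, sum_mul]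
    rw [sum_congr rfl h1]
    -- After the exchange the inner sum runs over all enlargements `t` of a fixed `s`, as the Pieri
    -- rule requires.
    rw [sum_comm' (t' := shapes n) (s' := fun s => (shapes (n + M N)).filter (StepLE s ·))
      (by
        intro t s
        simp only [mem_filter]
        tauto)]
    rw [sum_mul]
    refine sum_congr rfl fun s hs => ?_
    rw [← mul_sum, schurDet_pieri e₁ e₂ e₃ (M N) hs]
    ring

end Determinant

/-! ### Schur polynomials of shapes with at most one long row, modulo `e₃ ^ 2` -/

section Expansion

variable {R : Type*} [CommRing R]

/-- The complete symmetric function of degree `n` in two variables, in terms of the elementary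
symmetric functions `u` and `v`. -/
def twoVar (u v : R) (n : ℕ) : R :=
  ∑ k ∈ range (n + 1), (-1) ^ k * ((n - k).choose k : R) * (u ^ (n - 2 * k) * v ^ k)

/-- The coefficient of `e₃` in the complete symmetric function of degree `n + 3` in three
variables. -/
def twoVarDeriv (u v : R) (n : ℕ) : R :=
  ∑ k ∈ range (n + 1),
    (-1) ^ k * (((n - k + 1) * (n - k).choose k : ℕ) : R) * (u ^ (n - 2 * k) * v ^ k)

/-- Termwise Pascal's rule. It identifies the explicit sum with the coefficient of `t^n` in `1 / (1
- ut + vt²)`. -/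
theorem twoVar_add_two (u v : R) (n : ℕ) :
    twoVar u v (n + 2) = u * twoVar u v (n + 1) - v * twoVar u v n := by
  have h1 : twoVar u v (n + 2) = u ^ (n + 2) + ∑ j ∈ range (n + 1),
      (-1) ^ (j + 1) * ((n + 1 - j).choose (j + 1) : R) *
        (u ^ (n + 2 - 2 * (j + 1)) * v ^ (j + 1)) := by
    rw [twoVar, sum_range_succ, Nat.choose_eq_zero_of_lt (by omega), sum_range_succ']
    simp only [show ∀ j, n + 2 - (j + 1) = n + 1 - j by omega]
    simp
    ring
  have h2 : twoVar u v (n + 1) = u ^ (n + 1) + ∑ j ∈ range (n + 1),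
      (-1) ^ (j + 1) * ((n - j).choose (j + 1) : R) *
        (u ^ (n + 1 - 2 * (j + 1)) * v ^ (j + 1)) := by
    rw [twoVar, sum_range_succ']
    simp only [Nat.add_sub_add_right]
    simp
    ring
  rw [h1, h2, mul_add, mul_sum, twoVar, mul_sum, add_sub_assoc, ← sum_sub_distrib]
  congr 1
  · ring
  · refine sum_congr rfl fun j hj => ?_
    have hj := mem_range.1 hj
    rw [show n + 1 - j = n - j + 1 by omega, Nat.choose_succ_succ, Nat.cast_add,
      show n + 2 - 2 * (j + 1) = n - 2 * j by omega]
    -- Outside this range the exponent of `u` is truncated, but there the binomial coefficient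
    -- vanishes.
    by_cases h : 2 * (j + 1) ≤ n + 1
    · rw [show n - 2 * j = n + 1 - 2 * (j + 1) + 1 by omega]
      ring
    · rw [Nat.choose_eq_zero_of_lt (show n - j < j + 1 by omega)]
      ring

/-- Differentiating `1 / (1 - ut + vt² - e₃t³)` at `e₃ = 0` gives `t³ / (1 - ut + vt²)²`. One factor
of the denominator yields this recursion with `twoVar` as inhomogeneous term. -/
theorem twoVarDeriv_add_two (u v : R) (n : ℕ) : twoVarDeriv u v (n + 2) =
    u * twoVarDeriv u v (n + 1) - v * twoVarDeriv u v n + twoVar u v (n + 2) := by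
  have h1 : twoVarDeriv u v (n + 2) = (n + 3) * u ^ (n + 2) + ∑ j ∈ range (n + 1),
      (-1) ^ (j + 1) * (((n + 1 - j + 1) * (n + 1 - j).choose (j + 1) : ℕ) : R) *
        (u ^ (n + 2 - 2 * (j + 1)) * v ^ (j + 1)) := by
    rw [twoVarDeriv, sum_range_succ, Nat.choose_eq_zero_of_lt (by omega), sum_range_succ']
    simp only [show ∀ j, n + 2 - (j + 1) = n + 1 - j by omega]
    simp
    ring
  have h1' : twoVar u v (n + 2) = u ^ (n + 2) + ∑ j ∈ range (n + 1),
      (-1) ^ (j + 1) * ((n + 1 - j).choose (j + 1) : R) *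
        (u ^ (n + 2 - 2 * (j + 1)) * v ^ (j + 1)) := by
    rw [twoVar, sum_range_succ, Nat.choose_eq_zero_of_lt (by omega), sum_range_succ']
    simp only [show ∀ j, n + 2 - (j + 1) = n + 1 - j by omega]
    simp
    ring
  have h2 : twoVarDeriv u v (n + 1) = (n + 2) * u ^ (n + 1) + ∑ j ∈ range (n + 1),
      (-1) ^ (j + 1) * (((n - j + 1) * (n - j).choose (j + 1) : ℕ) : R) *
        (u ^ (n + 1 - 2 * (j + 1)) * v ^ (j + 1)) := by
    rw [twoVarDeriv, sum_range_succ']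
    simp only [Nat.add_sub_add_right]
    simp
    ring
  rw [h1, h1', h2, mul_add, mul_sum, twoVarDeriv, mul_sum, add_sub_assoc, ← sum_sub_distrib,
    add_add_add_comm, ← sum_add_distrib]
  congr 1
  · ring
  · refine sum_congr rfl fun j hj => ?_
    have hj := mem_range.1 hj
    rw [show n + 1 - j = n - j + 1 by omega, Nat.choose_succ_succ,
      show n + 2 - 2 * (j + 1) = n - 2 * j by omega]
    by_cases h : 2 * (j + 1) ≤ n + 1
    · rw [show n - 2 * j = n + 1 - 2 * (j + 1) + 1 by omega]
      push_cast
      ring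
    · rw [Nat.choose_eq_zero_of_lt (show n - j < j + 1 by omega)]
      push_cast
      ring

theorem twoVar_zero (u v : R) : twoVar u v 0 = 1 := by simp [twoVar]

theorem twoVar_one (u v : R) : twoVar u v 1 = u := by simp [twoVar, sum_range_succ]

theorem twoVarDeriv_zero (u v : R) : twoVarDeriv u v 0 = 1 := by simp [twoVarDeriv]

theorem twoVarDeriv_one (u v : R) : twoVarDeriv u v 1 = 2 * u := by
  simp only [twoVarDeriv, sum_range_succ, sum_range_zero]
  norm_num

/-- The coefficient of `e₃` in the complete symmetric function of degree `n`. -/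
def linearPart (u v : R) : ℕ → R
  | n + 3 => twoVarDeriv u v n
  | _ => 0

theorem linearPart_add_three (u v : R) (n : ℕ) : linearPart u v (n + 3) =
    u * linearPart u v (n + 2) - v * linearPart u v (n + 1) + twoVar u v n := by
  match n with
  | 0 => simp [linearPart, twoVarDeriv_zero, twoVar_zero]
  | 1 => simp [linearPart, twoVarDeriv_zero, twoVarDeriv_one, twoVar_one]; ring
  | n + 2 => exact twoVarDeriv_add_two u v n

variable (e₁ e₂ e₃ : R)

theorem complete_mod_sq (n : ℕ) : ∃ Z, complete e₁ e₂ e₃ (n + 2) =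
    twoVar e₁ e₂ n + e₃ * linearPart e₁ e₂ n + e₃ ^ 2 * Z := by
  induction n using Nat.strong_induction_on with
  | _ n ih =>
    match n with
    | 0 => exact ⟨0, by simp [complete, twoVar_zero, linearPart]⟩
    | 1 => exact ⟨0, by simp [complete, twoVar_one, linearPart]⟩
    | 2 => exact ⟨0, by simp [complete, twoVar_add_two, twoVar_zero, twoVar_one, linearPart]⟩
    | n + 3 =>
      obtain ⟨Z₂, h₂⟩ := ih (n + 2) (by omega)
      obtain ⟨Z₁, h₁⟩ := ih (n + 1) (by omega)
      obtain ⟨Z₀, h₀⟩ := ih n (by omega)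
      refine ⟨e₁ * Z₂ - e₂ * Z₁ + linearPart e₁ e₂ n + e₃ * Z₀, ?_⟩
      have h := complete_add_three e₁ e₂ e₃ (n + 2)
      rw [linearPart_add_three, show n + 3 = n + 1 + 2 from rfl, twoVar_add_two]
      linear_combination h + e₁ * h₂ - e₂ * h₁ + e₃ * h₀

theorem schurDet_succ (p q r : ℕ) : schurDet e₁ e₂ e₃ (p + 1, q + 1, r + 1) =
    e₃ * schurDet e₁ e₂ e₃ (p, q, r) :=
  detThree_pieri_three e₁ e₂ e₃ (p + 2) (q + 1) r

theorem schurDet_row (D : ℕ) :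
    schurDet e₁ e₂ e₃ (D, 0, 0) = complete e₁ e₂ e₃ (D + 2) := by
  simp [schurDet, detThree, complete]

/-- Multiplying the one-row polynomial by `e₂` gives the shapes `(D+2, 1, 0)` and `(D+1, 1, 1)`; the
latter has a full column, which splits off as `e₃`. -/
theorem schurDet_two_zero (D : ℕ) : schurDet e₁ e₂ e₃ (D + 2, 1, 0) =
    e₂ * schurDet e₁ e₂ e₃ (D + 1, 0, 0) - e₃ * schurDet e₁ e₂ e₃ (D, 0, 0) := by
  have h1 := detThree_pieri_two e₁ e₂ e₃ (D + 3) 1 0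
  have h2 := detThree_self_right e₁ e₂ e₃ (D + 4) 1
  have h3 := schurDet_succ e₁ e₂ e₃ D 0 0
  simp only [schurDet, zero_add] at h3 ⊢
  linear_combination h1 - h2 - h3

theorem schurDet_one_one : schurDet e₁ e₂ e₃ (1, 1, 0) = e₂ := by
  simp [schurDet, detThree, complete]

/-- In the Pieri rule for `e₂` the two unwanted shapes have a full column, hence a factor `e₃`. What
is left of them is, by the Pieri rule for `e₁`, the product of `e₁` with the shape `(C+D, C)` up to
a further multiple of `e₃`. -/
theorem schurDet_succ_succ (C D : ℕ) : ∃ Z, schurDet e₁ e₂ e₃ (C + 2 + D, C + 2, 0) =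
    e₂ * schurDet e₁ e₂ e₃ (C + 1 + D, C + 1, 0) - e₃ * (e₁ * schurDet e₁ e₂ e₃ (C + D, C, 0))
      + e₃ ^ 2 * Z := by
  have h1 := detThree_pieri_two e₁ e₂ e₃ (C + D + 3) (C + 2) 0
  have h2 := detThree_pieri_one e₁ e₂ e₃ (C + D + 2) (C + 1) 0
  have h3 := detThree_pieri_three e₁ e₂ e₃ (C + D + 3) (C + 1) 0
  have h4 := detThree_pieri_three e₁ e₂ e₃ (C + D + 2) (C + 2) 0
  -- The shape `(C+D, C, 1)`: for `C = 0` it is not a partition and the determinant vanishes,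
  -- otherwise it contains a full column.
  have h5 : ∃ Z, detThree e₁ e₂ e₃ (C + D + 2) (C + 1) 1 = e₃ * Z := by
    rcases C with _ | C
    · exact ⟨0, by rw [zero_add, zero_add, detThree_self_right]; ring⟩
    · refine ⟨detThree e₁ e₂ e₃ (C + D + 2) (C + 1) 0, ?_⟩
      rw [← detThree_pieri_three, show C + 1 + D + 2 = C + D + 2 + 1 by omega]
  obtain ⟨Z, h5⟩ := h5
  refine ⟨Z, ?_⟩
  simp only [schurDet]
  rw [show C + 2 + D + 2 = C + D + 3 + 1 by omega, show C + 1 + D + 2 = C + D + 3 by omega]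
  simp only [zero_add] at h1 h2 h3 h4
  linear_combination h1 - h3 - h4 - e₃ * h2 + e₃ * h5

/-- At `e₃ = 0` only two variables remain, and each of the `C` columns of length two splits off a
factor `e₂`. -/
theorem schurDet_mod (C D : ℕ) : ∃ Z, schurDet e₁ e₂ e₃ (C + D, C, 0) =
    e₂ ^ C * twoVar e₁ e₂ D + e₃ * Z := by
  induction C using Nat.strong_induction_on with
  | _ C ih =>
    match C with
    | 0 =>
      obtain ⟨Z, h⟩ := complete_mod_sq e₁ e₂ e₃ D
      rw [zero_add, schurDet_row, h]
      exact ⟨linearPart e₁ e₂ D + e₃ * Z, by ring⟩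
    | 1 =>
      rcases D with _ | D
      · exact ⟨0, by rw [schurDet_one_one, twoVar_zero]; ring⟩
      · obtain ⟨Z, h⟩ := ih 0 (by omega)
        rw [show 1 + (D + 1) = D + 2 by omega, schurDet_two_zero, ← zero_add (D + 1), h]
        exact ⟨e₂ * Z - schurDet e₁ e₂ e₃ (D, 0, 0), by rw [zero_add]; ring⟩
    | C + 2 =>
      obtain ⟨Z, h⟩ := schurDet_succ_succ e₁ e₂ e₃ C D
      obtain ⟨Z', h'⟩ := ih (C + 1) (by omega)
      rw [h, h']
      exact ⟨e₂ * Z' - e₁ * schurDet e₁ e₂ e₃ (C + D, C, 0) + e₃ * Z, by ring⟩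

theorem schurDet_mod_sq_one (D : ℕ) : ∃ Z, schurDet e₁ e₂ e₃ (D + 2, 1, 0) =
    e₂ * twoVar e₁ e₂ (D + 1)
      + e₃ * (e₂ * linearPart e₁ e₂ (D + 1) - twoVar e₁ e₂ D) + e₃ ^ 2 * Z := by
  obtain ⟨Z, h⟩ := complete_mod_sq e₁ e₂ e₃ (D + 1)
  obtain ⟨Z', h'⟩ := complete_mod_sq e₁ e₂ e₃ D
  rw [schurDet_two_zero, schurDet_row, schurDet_row, h, h']
  exact ⟨e₂ * Z - linearPart e₁ e₂ D - e₃ * Z', by ring⟩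

/-- Every application of `schurDet_succ_succ` multiplies by `e₂` and subtracts one more `e₁ e₂^C`
term, which explains the factor `C + 1`. The single term in `twoVar e₁ e₂ D` comes from the
exceptional first step `schurDet_two_zero`. -/
theorem schurDet_mod_sq (C D : ℕ) : ∃ Z, schurDet e₁ e₂ e₃ (C + 2 + (D + 1), C + 2, 0) =
    e₂ ^ (C + 2) * twoVar e₁ e₂ (D + 1)
      + e₃ * (e₂ ^ (C + 2) * linearPart e₁ e₂ (D + 1) - e₂ ^ (C + 1) * twoVar e₁ e₂ D
        - (C + 1) * (e₁ * e₂ ^ C * twoVar e₁ e₂ (D + 1))) + e₃ ^ 2 * Z := by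
  induction C with
  | zero =>
    obtain ⟨Z, h⟩ := schurDet_succ_succ e₁ e₂ e₃ 0 (D + 1)
    obtain ⟨Z₁, h₁⟩ := schurDet_mod_sq_one e₁ e₂ e₃ D
    obtain ⟨Z₀, h₀⟩ := schurDet_mod e₁ e₂ e₃ 0 (D + 1)
    rw [h, h₀, show 0 + 1 + (D + 1) = D + 2 by omega, zero_add, h₁]
    exact ⟨e₂ * Z₁ - e₁ * Z₀ + Z, by push_cast; ring⟩
  | succ C ih =>
    obtain ⟨Z, h⟩ := schurDet_succ_succ e₁ e₂ e₃ (C + 1) (D + 1)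
    obtain ⟨Z₁, h₁⟩ := ih
    obtain ⟨Z₀, h₀⟩ := schurDet_mod e₁ e₂ e₃ (C + 1) (D + 1)
    rw [h, h₀, show C + 1 + 1 + (D + 1) = C + 2 + (D + 1) by omega, h₁]
    exact ⟨e₂ * Z₁ - e₁ * Z₀ + Z, by push_cast; ring⟩

end Expansion

/-! ### Linear functionals on polynomials in the elementary symmetric functions -/

section Functional

open MvPolynomial

/-- The linear functional with value `w i j k` on the monomial `e₁ ^ i * e₂ ^ j * e₃ ^ k`. -/
noncomputable def functional (w : ℕ → ℕ → ℕ → ℚ) : MvPolynomial (Fin 3) ℚ →ₗ[ℚ] ℚ :=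
  (basisMonomials (Fin 3) ℚ).constr ℚ (fun m => w (m 0) (m 1) (m 2))

theorem functional_monomial (w : ℕ → ℕ → ℕ → ℚ) (m : Fin 3 →₀ ℕ) (c : ℚ) :
    functional w (monomial m c) = c * w (m 0) (m 1) (m 2) := by
  have h : monomial m c = c • basisMonomials (Fin 3) ℚ m := by
    rw [coe_basisMonomials, smul_monomial, smul_eq_mul, mul_one]
  rw [h, map_smul, functional, Module.Basis.constr_basis, smul_eq_mul]

theorem functional_pow (w : ℕ → ℕ → ℕ → ℚ) (i j k : ℕ) :
    functional w (X 0 ^ i * X 1 ^ j * X 2 ^ k) = w i j k := by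
  rw [X_pow_eq_monomial, X_pow_eq_monomial, X_pow_eq_monomial, monomial_mul, monomial_mul,
    functional_monomial]
  simp

/-- This is what permits computing modulo a power of `e₃`: remainders divisible by that power are
invisible to the functional. -/
theorem functional_mul_pow_eq_zero {w : ℕ → ℕ → ℕ → ℚ} {l : ℕ}
    (hw : ∀ i j k, l ≤ k → w i j k = 0) (Z : MvPolynomial (Fin 3) ℚ) :
    functional w (X 2 ^ l * Z) = 0 := by
  induction Z using MvPolynomial.induction_on' with
  | monomial m c =>
    rw [X_pow_eq_monomial, monomial_mul, functional_monomial, hw _ _ _ (by simp), mul_zero]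
  | add p q hp hq => rw [mul_add, map_add, hp, hq, add_zero]

theorem functional_twoVar (w : ℕ → ℕ → ℕ → ℚ) (i j k n : ℕ) :
    functional w (X 0 ^ i * X 1 ^ j * X 2 ^ k * twoVar (X 0) (X 1) n) =
      ∑ l ∈ range (n + 1), (-1) ^ l * ((n - l).choose l : ℚ) * w (i + (n - 2 * l)) (j + l) k := by
  rw [twoVar, mul_sum, map_sum]
  refine sum_congr rfl fun l _ => ?_
  have h : X 0 ^ i * X 1 ^ j * X 2 ^ k * ((-1) ^ l * ((n - l).choose l : MvPolynomial (Fin 3) ℚ) *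
      (X 0 ^ (n - 2 * l) * X 1 ^ l)) = ((-1) ^ l * ((n - l).choose l : ℚ)) •
      (X 0 ^ (i + (n - 2 * l)) * X 1 ^ (j + l) * X 2 ^ k) := by
    rw [smul_eq_C_mul]
    simp only [map_mul, map_pow, map_neg, map_one, map_natCast]
    ring
  rw [h, map_smul, functional_pow, smul_eq_mul]

theorem functional_twoVarDeriv (w : ℕ → ℕ → ℕ → ℚ) (j k n : ℕ) :
    functional w (X 1 ^ j * X 2 ^ k * twoVarDeriv (X 0) (X 1) n) =
      ∑ l ∈ range (n + 1), (-1) ^ l * (((n - l + 1) * (n - l).choose l : ℕ) : ℚ) *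
        w (n - 2 * l) (j + l) k := by
  rw [twoVarDeriv, mul_sum, map_sum]
  refine sum_congr rfl fun l _ => ?_
  have h : X 1 ^ j * X 2 ^ k *
      ((-1) ^ l * (((n - l + 1) * (n - l).choose l : ℕ) : MvPolynomial (Fin 3) ℚ) *
      (X 0 ^ (n - 2 * l) * X 1 ^ l)) =
      ((-1) ^ l * (((n - l + 1) * (n - l).choose l : ℕ) : ℚ)) •
      (X 0 ^ (n - 2 * l) * X 1 ^ (j + l) * X 2 ^ k) := by
    rw [smul_eq_C_mul]
    simp only [map_mul, map_pow, map_neg, map_one, map_natCast]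
    ring
  rw [h, map_smul, functional_pow, smul_eq_mul]

/-- The number of variables whose exponent in `m` is `k`. -/
def mult (m : ℕ →₀ ℕ) (k : ℕ) : ℕ := (m.support.filter (fun i => m i = k)).card

theorem prod_elem {m : ℕ →₀ ℕ} (h : ∀ i, m i ≤ 3) {R : Type*} [CommRing R] (e₁ e₂ e₃ : R) :
    ∏ i ∈ m.support, elem e₁ e₂ e₃ (m i) =
      e₁ ^ mult m 1 * e₂ ^ mult m 2 * e₃ ^ mult m 3 := by
  have h1 : ∀ i ∈ m.support, elem e₁ e₂ e₃ (m i) = (if m i = 1 then e₁ else 1) *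
      (if m i = 2 then e₂ else 1) * (if m i = 3 then e₃ else 1) := fun i hi => by
    have h2 := h i
    have h3 := Finsupp.mem_support_iff.1 hi
    generalize m i = k at *
    interval_cases k <;> simp_all [elem]
  rw [prod_congr rfl h1, prod_mul_distrib, prod_mul_distrib]
  simp only [prod_ite, prod_const, one_pow, mul_one, mult]

theorem prod_elem_eq_zero {m : ℕ →₀ ℕ} {j : ℕ} (h : 3 < m j) {R : Type*} [CommRing R]
    (e₁ e₂ e₃ : R) : ∏ i ∈ m.support, elem e₁ e₂ e₃ (m i) = 0 := by
  refine prod_eq_zero (i := j) (Finsupp.mem_support_iff.2 (by omega)) ?_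
  obtain ⟨k, hk⟩ := Nat.exists_eq_add_of_lt h
  rw [show m j = k + 4 by omega]
  rfl

/-- A symmetric series, homogeneous of degree `n`, whose coefficients are given by a functional on
polynomials in the elementary symmetric functions, is a combination of the Schur functions of
diagrams with at most three columns. -/
theorem eq_linearCombination_schur {f : MvPowerSeries ℕ ℚ} {n : ℕ}
    (L : MvPolynomial (Fin 3) ℚ →ₗ[ℚ] ℚ) (hdeg : ∀ m : ℕ →₀ ℕ, m.degree ≠ n → f m = 0)
    (hf : ∀ m : ℕ →₀ ℕ, m.degree = n →
      f m = L (∏ i ∈ m.support, elem (X 0) (X 1) (X 2) (m i))) :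
    f = Finsupp.linearCombination ℚ schur
      (∑ t ∈ shapes n, Finsupp.single (diagram t) (L (schurDet (X 0) (X 1) (X 2) t))) := by
  funext m
  have h1 : Finsupp.linearCombination ℚ schur
      (∑ t ∈ shapes n, Finsupp.single (diagram t) (L (schurDet (X 0) (X 1) (X 2) t))) m =
      ∑ t ∈ shapes n, L (schurDet (X 0) (X 1) (X 2) t) * (kostka (diagram t) m : ℚ) := by
    rw [map_sum]
    refine (Finset.sum_apply m _ _).trans (sum_congr rfl fun t _ => ?_)
    rw [Finsupp.linearCombination_single]
    rfl
  rw [h1]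
  by_cases hm : m.degree = n
  · obtain ⟨N, hN⟩ : ∃ N, m.support ⊆ range N :=
      ⟨m.support.sup id + 1, fun i hi => mem_range.2 (Nat.lt_succ_of_le (le_sup (f := id) hi))⟩
    have hN' : ∀ k, N ≤ k → m k = 0 := fun k hk => by
      by_contra hc
      have := mem_range.1 (hN (Finsupp.mem_support_iff.2 hc))
      omega
    have hsum : ∑ i ∈ range N, m i = n := by
      rw [← hm, Finsupp.degree]
      exact (sum_subset hN fun i _ hi => Finsupp.notMem_support_iff.1 hi).symm
    -- Applying `L` to this identity in the polynomial ring turns its Schur polynomials into the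
    -- claimed coefficients.
    have key := sum_kostka_schurDet (X 0) (X 1) (X 2 : MvPolynomial (Fin 3) ℚ) N m hN'
    rw [hsum, ← prod_subset hN fun i _ hi => by
      rw [Finsupp.notMem_support_iff.1 hi, elem]] at key
    rw [hf m hm, ← key, map_sum]
    refine sum_congr rfl fun t _ => ?_
    rw [← nsmul_eq_mul, map_nsmul, nsmul_eq_mul, mul_comm]
  · rw [hdeg m hm]
    symm
    refine sum_eq_zero fun t ht => ?_
    rw [kostka_eq_zero_of_degree (by rwa [card_diagram ht]), Nat.cast_zero, mul_zero]

end Functional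

/-! ### Arrangements avoiding successions -/

section Arrangements

variable {V : Type*}

/-- The arrangements of the elements of `S` in which no element is immediately followed by an
element to which it is related by `r`. -/
def arrangements (S : Finset V) (r : V → V → Prop) : Set (List V) :=
  {s | (s.Nodup ∧ ∀ v, v ∈ s ↔ v ∈ S) ∧ s.IsChain (fun v w => ¬ r v w)}

/-- The number of arrangements of `S` avoiding `r`. -/
noncomputable def numArr (S : Finset V) (r : V → V → Prop) : ℕ := (arrangements S r).ncard

/-- Neighbours in a list without repetition are distinct, so the relations need not agree on the
diagonal. -/
theorem isChain_congr {s : List V} (hs : s.Nodup) {r r' : V → V → Prop}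
    (h : ∀ v ∈ s, ∀ w ∈ s, v ≠ w → (r v w ↔ r' v w)) : s.IsChain r ↔ s.IsChain r' := by
  rw [List.isChain_iff_forall_rel_of_append_cons_cons,
    List.isChain_iff_forall_rel_of_append_cons_cons]
  refine forall₅_congr fun a b l₁ l₂ hl => ?_
  subst hl
  refine h a (by simp) b (by simp) ?_
  rintro rfl
  simp [List.nodup_append] at hs

theorem arrangements_congr {S : Finset V} {r r' : V → V → Prop}
    (h : ∀ v ∈ S, ∀ w ∈ S, v ≠ w → (r v w ↔ r' v w)) :
    arrangements S r = arrangements S r' := by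
  ext s
  refine and_congr_right fun hs => isChain_congr hs.1 fun v hv w hw hvw => ?_
  rw [h v ((hs.2 v).1 hv) w ((hs.2 w).1 hw) hvw]

theorem numArr_congr {S : Finset V} {r r' : V → V → Prop}
    (h : ∀ v ∈ S, ∀ w ∈ S, v ≠ w → (r v w ↔ r' v w)) : numArr S r = numArr S r' := by
  rw [numArr, numArr, arrangements_congr h]

theorem mem_permutations_toList {S : Finset V} {s : List V} :
    s ∈ S.toList.permutations ↔ s.Nodup ∧ ∀ v, v ∈ s ↔ v ∈ S := by
  rw [List.mem_permutations]
  constructor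
  · intro h
    exact ⟨h.nodup_iff.2 S.nodup_toList, fun v => by rw [h.mem_iff, mem_toList]⟩
  · rintro ⟨h1, h2⟩
    exact (List.perm_ext_iff_of_nodup h1 S.nodup_toList).2 fun v => by rw [h2, mem_toList]

theorem arrangements_finite (S : Finset V) (r : V → V → Prop) : (arrangements S r).Finite :=
  (List.finite_toSet S.toList.permutations).subset fun _ hs => mem_permutations_toList.2 hs.1

theorem numArr_false (S : Finset V) : numArr S (fun _ _ => False) = S.card ! := by
  classical
  have h : arrangements S (fun _ _ => False) = S.toList.permutations.toFinset := by
    ext s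
    rw [Finset.mem_coe, List.mem_toFinset, mem_permutations_toList]
    refine and_iff_left ?_
    rw [List.isChain_iff_forall_rel_of_append_cons_cons]
    simp
  rw [numArr, h, Set.ncard_coe_finset, List.toFinset_card_of_nodup, List.length_permutations,
    length_toList]
  exact List.nodup_permutations _ S.nodup_toList

/-- Deletion and contraction of a forbidden succession. -/
theorem numArr_deletion_contraction [DecidableEq V] {S : Finset V} {r r' r'' : V → V → Prop}
    {x y : V} (hx : x ∈ S) (hy : y ∈ S) (hxy : x ≠ y) (hr' : ¬ r' x y)
    (hr : ∀ v ∈ S, ∀ w ∈ S, r v w ↔ r' v w ∨ (v = x ∧ w = y))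
    (h₁ : ∀ v ∈ S, ∀ w ∈ S, v ≠ x → v ≠ y → w ≠ y → (r'' v w ↔ r' v w))
    (h₂ : ∀ w ∈ S, w ≠ x → w ≠ y → (r'' x w ↔ r' y w)) :
    numArr S r' = numArr S r + numArr (S.erase y) r'' := by
  -- An arrangement avoiding `r'` either has no succession `x, y`, hence avoids `r`, or contains
  -- that succession.
  have hsplit : arrangements S r' = arrangements S r ∪
      {s ∈ arrangements S r' | ∃ l₁ l₂, s = l₁ ++ x :: y :: l₂} := by
    ext s
    simp only [arrangements, Set.mem_union, Set.mem_ofPred_eq,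
      List.isChain_iff_forall_rel_of_append_cons_cons]
    constructor
    · rintro ⟨h, hc⟩
      by_cases he : ∃ l₁ l₂, s = l₁ ++ x :: y :: l₂
      · exact Or.inr ⟨⟨h, hc⟩, he⟩
      · refine Or.inl ⟨h, fun a b l₁ l₂ hl => ?_⟩
        rw [hr a ((h.2 a).1 (by simp [hl])) b ((h.2 b).1 (by simp [hl]))]
        rintro (h3 | ⟨rfl, rfl⟩)
        · exact hc hl h3
        · exact he ⟨l₁, l₂, hl⟩
    · rintro (⟨h, hc⟩ | ⟨h, -⟩)
      · refine ⟨h, fun a b l₁ l₂ hl h3 => hc hl ?_⟩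
        rw [hr a ((h.2 a).1 (by simp [hl])) b ((h.2 b).1 (by simp [hl]))]
        exact Or.inl h3
      · exact h
  have hdisj : Disjoint (arrangements S r)
      {s ∈ arrangements S r' | ∃ l₁ l₂, s = l₁ ++ x :: y :: l₂} := by
    refine Set.disjoint_left.2 ?_
    rintro s ⟨-, hc⟩ ⟨-, l₁, l₂, hl⟩
    rw [List.isChain_iff_forall_rel_of_append_cons_cons] at hc
    exact hc hl ((hr x hx y hy).2 (Or.inr ⟨rfl, rfl⟩))
  -- The block `x, y` is replaced by the letter `x`: as a successor it behaves like `x` under `r'`,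
  -- as a predecessor like `y`. The hypotheses on `r''` say precisely this.
  have hchain : ∀ l₁ l₂ : List V, (l₁ ++ x :: y :: l₂).Nodup →
      (∀ v ∈ l₁ ++ x :: y :: l₂, v ∈ S) →
      ((l₁ ++ x :: y :: l₂).IsChain (fun v w => ¬ r' v w) ↔
        (l₁ ++ x :: l₂).IsChain (fun v w => ¬ r'' v w)) := by
    intro l₁ l₂ hn hS
    have hn' := List.nodup_append.1 hn
    simp only [List.nodup_cons, List.mem_cons, not_or] at hn'
    have e1 : l₁.IsChain (fun v w => ¬ r' v w) ↔ l₁.IsChain (fun v w => ¬ r'' v w) := by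
      refine isChain_congr hn'.1 fun v hv w hw _ => ?_
      rw [h₁ v (hS v (by simp [hv])) w (hS w (by simp [hw])) (hn'.2.2 v hv x (by simp))
        (hn'.2.2 v hv y (by simp)) (hn'.2.2 w hw y (by simp))]
    have e2 : l₂.IsChain (fun v w => ¬ r' v w) ↔ l₂.IsChain (fun v w => ¬ r'' v w) := by
      refine isChain_congr hn'.2.1.2.2 fun v hv w hw _ => ?_
      rw [h₁ v (hS v (by simp [hv])) w (hS w (by simp [hw]))]
      · rintro rfl; exact hn'.2.1.1.2 hv
      · rintro rfl; exact hn'.2.1.2.1 hv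
      · rintro rfl; exact hn'.2.1.2.1 hw
    rw [List.isChain_append, List.isChain_append, List.isChain_cons, List.isChain_cons,
      List.isChain_cons, e1, e2]
    have e3 : ∀ b ∈ l₂.head?, (¬ r' y b ↔ ¬ r'' x b) := fun b hb => by
      have hb' : b ∈ l₂ := List.mem_of_mem_head? hb
      rw [h₂ b (hS b (by simp [hb']))]
      · rintro rfl; exact hn'.2.1.1.2 hb'
      · rintro rfl; exact hn'.2.1.2.1 hb'
    have e4 : ∀ a ∈ l₁.getLast?, (¬ r' a x ↔ ¬ r'' a x) := fun a ha => by
      have ha' : a ∈ l₁ := List.mem_of_mem_getLast? ha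
      rw [h₁ a (hS a (by simp [ha'])) x hx (hn'.2.2 a ha' x (by simp))
        (hn'.2.2 a ha' y (by simp)) hxy]
    simp only [List.head?_cons, Option.mem_def, Option.some.injEq, forall_eq']
    constructor
    · rintro ⟨a, ⟨-, c, d⟩, f⟩
      exact ⟨a, ⟨fun b hb => (e3 b hb).1 (c b hb), d⟩, fun b hb => (e4 b hb).1 (f b hb)⟩
    · rintro ⟨a, ⟨c, d⟩, f⟩
      exact ⟨a, ⟨hr', fun b hb => (e3 b hb).2 (c b hb), d⟩, fun b hb => (e4 b hb).2 (f b hb)⟩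
  have herase : ∀ l₁ l₂ : List V, (l₁ ++ x :: y :: l₂).Nodup →
      (l₁ ++ x :: y :: l₂).erase y = l₁ ++ x :: l₂ := by
    intro l₁ l₂ hn
    have hn' := List.nodup_append.1 hn
    rw [List.erase_append_right _ (fun h => hn'.2.2 y h y (by simp) rfl),
      List.erase_cons_tail (by simpa using hxy), List.erase_cons_head]
  have hbij : Set.BijOn (fun s : List V => s.erase y)
      {s ∈ arrangements S r' | ∃ l₁ l₂, s = l₁ ++ x :: y :: l₂}
      (arrangements (S.erase y) r'') := by
    refine ⟨?_, ?_, ?_⟩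
    · rintro s ⟨⟨⟨hn, hS⟩, hc⟩, l₁, l₂, rfl⟩
      refine ⟨⟨hn.erase y, fun v => ?_⟩, ?_⟩
      · rw [hn.mem_erase_iff, hS, mem_erase]
      · simp only
        rw [herase _ _ hn, ← hchain _ _ hn fun v hv => (hS v).1 hv]
        exact hc
    · rintro s ⟨⟨⟨hn, hS⟩, hc⟩, l₁, l₂, rfl⟩ t ⟨⟨⟨hn', hS'⟩, hc'⟩, l₁', l₂', rfl⟩ h
      simp only at h
      rw [herase _ _ hn, herase _ _ hn'] at h
      have hx1 := (List.nodup_append.1 hn).2.2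
      have hx2 := (List.nodup_append.1 hn').2.2
      have hy1 := (List.nodup_append.1 hn).2.1
      have hy2 := (List.nodup_append.1 hn').2.1
      simp only [List.nodup_cons, List.mem_cons, not_or] at hy1 hy2
      obtain ⟨rfl, -, rfl⟩ := (List.append_cons_inj_of_notMem
        (fun hm => hx1 x hm x (by simp) rfl) hy1.1.2).1 h
      rfl
    · rintro t ⟨⟨hn, hS⟩, hc⟩
      have hxt : x ∈ t := (hS x).2 (mem_erase.2 ⟨hxy, hx⟩)
      have hyt : y ∉ t := fun h => (mem_erase.1 ((hS y).1 h)).1 rfl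
      obtain ⟨l₁, l₂, rfl⟩ := List.append_of_mem hxt
      have hn1 : (l₁ ++ x :: y :: l₂).Nodup := by
        simp only [List.nodup_append, List.nodup_cons, List.mem_cons, List.mem_append,
          not_or] at hn hyt ⊢
        refine ⟨hn.1, ⟨⟨hxy, hn.2.1.1⟩, hyt.2.2, hn.2.1.2⟩, ?_⟩
        rintro a ha b (rfl | rfl | hb)
        · exact hn.2.2 a ha b (Or.inl rfl)
        · rintro rfl; exact hyt.1 ha
        · exact hn.2.2 a ha b (Or.inr hb)
      have hS1 : ∀ v, v ∈ l₁ ++ x :: y :: l₂ ↔ v ∈ S := by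
        intro v
        by_cases hv : v = y
        · subst hv
          simp [hy]
        · have := hS v
          simp only [List.mem_append, List.mem_cons, mem_erase] at this ⊢
          tauto
      refine ⟨l₁ ++ x :: y :: l₂, ⟨⟨⟨hn1, hS1⟩, ?_⟩, l₁, l₂, rfl⟩, herase _ _ hn1⟩
      exact (hchain _ _ hn1 fun v hv => (hS1 v).1 hv).2 hc
  rw [numArr, hsplit, Set.ncard_union_eq hdisj (arrangements_finite _ _)
    ((arrangements_finite S r').subset fun _ h => h.1), hbij.ncard_eq]
  rfl

/-- The number of arrangements of `s` objects avoiding `m` disjoint successions. -/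
def avoidCount (m s : ℕ) : ℚ := ∑ k ∈ range (m + 1), (-1) ^ k * (m.choose k : ℚ) * ((s - k) ! : ℚ)

theorem avoidCount_zero (s : ℕ) : avoidCount 0 s = s ! := by simp [avoidCount]

/-- Pascal's rule, matching deletion and contraction of one forbidden succession. -/
theorem avoidCount_succ (m s : ℕ) :
    avoidCount (m + 1) s = avoidCount m s - avoidCount m (s - 1) := by
  have h : avoidCount m s = ((s ! : ℕ) : ℚ) +
      ∑ k ∈ range (m + 1), (-1) ^ (k + 1) * (m.choose (k + 1) : ℚ) * ((s - (k + 1)) ! : ℚ) := by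
    have := sum_range_succ (fun k => (-1) ^ k * (m.choose k : ℚ) * ((s - k) ! : ℚ)) (m + 1)
    rw [Nat.choose_eq_zero_of_lt (Nat.lt_succ_self m), sum_range_succ'] at this
    rw [avoidCount]
    simp only [Nat.cast_zero, mul_zero, zero_mul, add_zero] at this
    rw [← this]
    simp
    ring
  have h' : ∑ k ∈ range (m + 1), (-1) ^ (k + 1) * ((m + 1).choose (k + 1) : ℚ) *
      ((s - (k + 1)) ! : ℚ) =
      ∑ k ∈ range (m + 1), (-1) ^ (k + 1) * (m.choose (k + 1) : ℚ) * ((s - (k + 1)) ! : ℚ) -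
      ∑ k ∈ range (m + 1), (-1) ^ k * (m.choose k : ℚ) * ((s - 1 - k) ! : ℚ) := by
    rw [← sum_sub_distrib]
    refine sum_congr rfl fun k _ => ?_
    rw [Nat.choose_succ_succ, Nat.cast_add, show s - (k + 1) = s - 1 - k by omega]
    ring
  rw [h, avoidCount, sum_range_succ', h', avoidCount]
  simp only [pow_zero, Nat.choose_zero_right, Nat.sub_zero, Nat.cast_one, one_mul]
  ring

/-- Induction on the matching: contracting a pair that shares no endpoint with the others leaves the
remaining matching intact on a set with one element fewer. -/
theorem numArr_matching [DecidableEq V] (L : Finset (V × V)) : ∀ S : Finset V,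
    (∀ e ∈ L, e.1 ∈ S ∧ e.2 ∈ S ∧ e.1 ≠ e.2) →
    (∀ e ∈ L, ∀ f ∈ L, e ≠ f → e.1 ≠ f.1 ∧ e.1 ≠ f.2 ∧ e.2 ≠ f.2) →
    (numArr S (fun v w => (v, w) ∈ L) : ℚ) = avoidCount L.card S.card := by
  induction L using Finset.induction_on with
  | empty =>
    intro S _ _
    rw [card_empty, avoidCount_zero, ← numArr_false]
    simp
  | insert e L he ih =>
    intro S hS hL
    obtain ⟨x, y⟩ := e
    obtain ⟨hx, hy, hxy⟩ := hS (x, y) (mem_insert_self _ _)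
    have hne : ∀ f ∈ L, (x, y) ≠ f := fun f hf h => he (h ▸ hf)
    have hd : ∀ f ∈ L, x ≠ f.1 ∧ x ≠ f.2 ∧ y ≠ f.2 ∧ f.1 ≠ y := fun f hf => by
      obtain ⟨h1, h2, h3⟩ := hL (x, y) (mem_insert_self _ _) f (mem_insert_of_mem hf) (hne f hf)
      obtain ⟨-, h4, -⟩ := hL f (mem_insert_of_mem hf) (x, y) (mem_insert_self _ _)
        (hne f hf).symm
      exact ⟨h1, h2, h3, h4⟩
    have key := numArr_deletion_contraction (S := S) (r := fun v w => (v, w) ∈ insert (x, y) L)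
      (r' := fun v w => (v, w) ∈ L) (r'' := fun v w => (v, w) ∈ L) hx hy hxy he
      (fun v _ w _ => by rw [mem_insert, Prod.mk.injEq]; tauto)
      (fun _ _ _ _ _ _ _ => Iff.rfl)
      (fun w _ _ _ => ⟨fun h => absurd rfl (hd _ h).1, fun h => absurd rfl (hd _ h).2.2.2⟩)
    have i1 := ih S (fun f hf => hS f (mem_insert_of_mem hf))
      (fun f hf g hg => hL f (mem_insert_of_mem hf) g (mem_insert_of_mem hg))
    have i2 := ih (S.erase y) (fun f hf => by
        obtain ⟨h1, h2, h3⟩ := hS f (mem_insert_of_mem hf)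
        obtain ⟨-, -, h4, h5⟩ := hd f hf
        exact ⟨mem_erase.2 ⟨h5, h1⟩, mem_erase.2 ⟨h4.symm, h2⟩, h3⟩)
      (fun f hf g hg => hL f (mem_insert_of_mem hf) g (mem_insert_of_mem hg))
    rw [card_insert_of_notMem he, avoidCount_succ, ← i1, ← card_erase_of_mem hy, ← i2, key]
    push_cast
    ring

/-- Inclusion and exclusion over the successions `pq`, `pr`, `qr` of a three-element chain: each
alone makes one block, and the only compatible combination is `pq` with `qr`, which forms the block
`pqr`. -/
theorem numArr_chain_matching [DecidableEq V] (L : Finset (V × V)) (S : Finset V) {p q r : V}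
    (hp : p ∈ S) (hq : q ∈ S) (hr : r ∈ S) (hpq : p ≠ q) (hpr : p ≠ r) (hqr : q ≠ r)
    (hS : ∀ e ∈ L, e.1 ∈ S ∧ e.2 ∈ S ∧ e.1 ≠ e.2)
    (hL : ∀ e ∈ L, ∀ f ∈ L, e ≠ f → e.1 ≠ f.1 ∧ e.1 ≠ f.2 ∧ e.2 ≠ f.2)
    (hd : ∀ e ∈ L, ∀ v, v = p ∨ v = q ∨ v = r → e.1 ≠ v ∧ e.2 ≠ v) :
    (numArr S (fun v w => (v, w) ∈ L ∨ (v = p ∧ w = q) ∨ (v = p ∧ w = r) ∨ (v = q ∧ w = r)) : ℚ)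
      = avoidCount L.card S.card - 3 * avoidCount L.card (S.card - 1)
        + avoidCount L.card (S.card - 2) := by
  have hp' : ∀ w, (p, w) ∉ L := fun w h => (hd _ h p (by simp)).1 rfl
  have hq' : ∀ w, (q, w) ∉ L := fun w h => (hd _ h q (by simp)).1 rfl
  have hr' : ∀ w, (r, w) ∉ L := fun w h => (hd _ h r (by simp)).1 rfl
  have insert_matching : ∀ S' : Finset V, (∀ e ∈ L, e.1 ∈ S' ∧ e.2 ∈ S' ∧ e.1 ≠ e.2) →
      ∀ x : V, x = p ∨ x = q → x ∈ S' → r ∈ S' → (numArr S' (fun v w => (v, w) ∈ L ∨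
        (v = x ∧ w = r)) : ℚ) = avoidCount (L.card + 1) S'.card := by
    intro S' hS' x hx hxS hrS
    have hxr : x ≠ r := by rcases hx with rfl | rfl <;> assumption
    have hxL : (x, r) ∉ L := by rcases hx with rfl | rfl <;> apply_assumption
    have hdx : ∀ e ∈ L, e.1 ≠ x ∧ e.2 ≠ x := fun e he => hd e he x (by tauto)
    have hdr : ∀ e ∈ L, e.1 ≠ r ∧ e.2 ≠ r := fun e he => hd e he r (by tauto)
    rw [← card_insert_of_notMem hxL, ← numArr_matching (insert (x, r) L) S']
    · congr 1
      refine numArr_congr fun v _ w _ _ => ?_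
      rw [mem_insert, Prod.mk.injEq]
      tauto
    · intro e he
      rcases mem_insert.1 he with rfl | he
      · exact ⟨hxS, hrS, hxr⟩
      · exact hS' e he
    · intro e he f hf hef
      rcases mem_insert.1 he with rfl | he <;> rcases mem_insert.1 hf with rfl | hf
      · exact absurd rfl hef
      · exact ⟨(hdx f hf).1.symm, (hdx f hf).2.symm, (hdr f hf).2.symm⟩
      · exact ⟨(hdx e he).1, (hdr e he).1, (hdr e he).2⟩
      · exact hL e he f hf hef
  have hSe : ∀ x, x = p ∨ x = q ∨ x = r →
      ∀ e ∈ L, e.1 ∈ S.erase x ∧ e.2 ∈ S.erase x ∧ e.1 ≠ e.2 := fun x hx e he =>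
    ⟨mem_erase.2 ⟨(hd e he x hx).1, (hS e he).1⟩, mem_erase.2 ⟨(hd e he x hx).2, (hS e he).2.1⟩,
      (hS e he).2.2⟩
  -- Contracting `pq` to `p` turns the forbidden succession `qr` into `pr`; the old `pr` becomes
  -- void because `p` is no longer last in its block.
  have k1 := numArr_deletion_contraction (S := S)
    (r := fun v w => (v, w) ∈ L ∨ (v = p ∧ w = q) ∨ (v = p ∧ w = r) ∨ (v = q ∧ w = r))
    (r' := fun v w => (v, w) ∈ L ∨ (v = p ∧ w = r) ∨ (v = q ∧ w = r))
    (r'' := fun v w => (v, w) ∈ L ∨ (v = p ∧ w = r)) hp hq hpq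
    (by have := hp' q; tauto) (fun v _ w _ => by tauto)
    (fun v _ w _ _ _ _ => by tauto)
    (fun w _ _ _ => by have := hp' w; have := hq' w; tauto)
  -- Once `p` and `r` form a block, nothing else can precede `r` directly, so `qr` drops out and the
  -- matching remains.
  have k2 := numArr_deletion_contraction (S := S)
    (r := fun v w => (v, w) ∈ L ∨ (v = p ∧ w = r) ∨ (v = q ∧ w = r))
    (r' := fun v w => (v, w) ∈ L ∨ (v = q ∧ w = r))
    (r'' := fun v w => (v, w) ∈ L) hp hr hpr
    (by have := hp' r; tauto) (fun v _ w _ => by tauto)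
    (fun v _ w _ _ _ _ => by tauto)
    (fun w _ _ _ => by have := hp' w; have := hr' w; have := hqr.symm; tauto)
  have i1 := insert_matching S hS q (Or.inr rfl) hq hr
  have i2 := insert_matching (S.erase q) (hSe q (by tauto)) p (Or.inl rfl)
    (mem_erase.2 ⟨hpq, hp⟩) (mem_erase.2 ⟨hqr.symm, hr⟩)
  have i3 := numArr_matching L (S.erase r) (hSe r (by tauto)) hL
  rw [card_erase_of_mem hq, avoidCount_succ] at i2
  rw [card_erase_of_mem hr] at i3
  rw [avoidCount_succ] at i1
  have k1' := congrArg (Nat.cast (R := ℚ)) k1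
  have k2' := congrArg (Nat.cast (R := ℚ)) k2
  push_cast at k1' k2'
  rw [show S.card - 2 = S.card - 1 - 1 by omega]
  linarith

end Arrangements

/-! ### Spanning non-increasing sequences of disjoint unions of chains -/

section ChainsPoset

variable {l : List ℕ}

theorem chains_ext_iff {v w : Chains l} : v = w ↔ v.1 = w.1 ∧ v.2.val = w.2.val := by
  obtain ⟨i, a⟩ := v
  obtain ⟨j, b⟩ := w
  constructor
  · intro h
    cases h
    exact ⟨rfl, rfl⟩
  · rintro ⟨h1, h2⟩
    simp only at h1
    subst h1
    rw [Fin.ext (show a.val = b.val from h2)]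

theorem chains_lt_iff {v w : Chains l} : v < w ↔ v.1 = w.1 ∧ v.2.val < w.2.val := by
  obtain ⟨i, a⟩ := v
  obtain ⟨j, b⟩ := w
  constructor
  · intro h
    obtain ⟨h1, h2⟩ := Sigma.lt_def.1 h
    simp only at h1
    subst h1
    exact ⟨rfl, h2⟩
  · rintro ⟨h1, h2⟩
    simp only at h1
    subst h1
    exact Sigma.mk_lt_mk_iff.2 h2

theorem Nsp_eq_numArr (l : List ℕ) : Nsp l = numArr univ (fun v w : Chains l => v < w) := by
  have h : {s : List (Chains l) | IsSpanningNonIncreasing s} =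
      arrangements univ (fun v w : Chains l => v < w) := by
    ext s
    simp only [IsSpanningNonIncreasing, arrangements, Set.mem_ofPred_eq, mem_univ, iff_true]
    refine and_congr_right fun hs => isChain_congr hs.1 fun v _ w _ hvw => ?_
    rw [lt_iff_le_and_ne]
    tauto
  rw [Nsp, numSpanningNonIncreasing, numArr, ← h, ← Nat.card_coe_set_eq]
  rfl

/-- The covering pairs of the chains of length two. -/
def coverPairs (l : List ℕ) : Finset (Chains l × Chains l) :=
  univ.filter (fun e => l.get e.1.1 = 2 ∧ e.1.1 = e.2.1 ∧ e.1.2.val = 0 ∧ e.2.2.val = 1)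

theorem mem_coverPairs {v w : Chains l} : (v, w) ∈ coverPairs l ↔
    l.get v.1 = 2 ∧ v.1 = w.1 ∧ v.2.val = 0 ∧ w.2.val = 1 := by
  simp [coverPairs]

theorem card_coverPairs (l : List ℕ) : (coverPairs l).card = l.count 2 := by
  have h := Fin.card_filter_univ_eq_vector_get_eq_count 2 (⟨l, rfl⟩ : List.Vector ℕ l.length)
  refine Eq.trans ?_ h
  refine card_bij (fun e _ => e.1.1) ?_ ?_ ?_
  · rintro ⟨v, w⟩ he
    exact mem_filter.2 ⟨mem_univ _, (mem_coverPairs.1 he).1⟩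
  · rintro ⟨v, w⟩ he ⟨v', w'⟩ he' h
    obtain ⟨-, h1, h2, h3⟩ := mem_coverPairs.1 he
    obtain ⟨-, h1', h2', h3'⟩ := mem_coverPairs.1 he'
    simp only at h
    rw [Prod.mk.injEq, chains_ext_iff, chains_ext_iff]
    exact ⟨⟨h, by rw [h2, h2']⟩, by rw [← h1, ← h1', h], by rw [h3, h3']⟩
  · intro i hi
    have hi' : l.get i = 2 := (mem_filter.1 hi).2
    exact ⟨(⟨i, ⟨0, by omega⟩⟩, ⟨i, ⟨1, by omega⟩⟩), mem_coverPairs.2 ⟨hi', rfl, rfl, rfl⟩, rfl⟩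

theorem coverPairs_ne (e : Chains l × Chains l) (he : e ∈ coverPairs l) :
    e.1 ∈ univ ∧ e.2 ∈ univ ∧ e.1 ≠ e.2 := by
  refine ⟨mem_univ _, mem_univ _, fun h => ?_⟩
  obtain ⟨-, -, h2, h3⟩ := mem_coverPairs.1 he
  rw [h] at h2
  omega

theorem coverPairs_disjoint (e : Chains l × Chains l) (he : e ∈ coverPairs l)
    (f : Chains l × Chains l) (hf : f ∈ coverPairs l) (hef : e ≠ f) :
    e.1 ≠ f.1 ∧ e.1 ≠ f.2 ∧ e.2 ≠ f.2 := by
  obtain ⟨-, h1, h2, h3⟩ := mem_coverPairs.1 he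
  obtain ⟨-, h1', h2', h3'⟩ := mem_coverPairs.1 hf
  have key : e.1.1 ≠ f.1.1 := fun h => hef <| by
    rw [Prod.ext_iff, chains_ext_iff, chains_ext_iff]
    exact ⟨⟨h, by rw [h2, h2']⟩, by rw [← h1, ← h1', h], by rw [h3, h3']⟩
  refine ⟨fun h => key (by rw [h]), fun h => key (by rw [h, h1']), fun h => key ?_⟩
  rw [h1, h, h1']

theorem card_chains (l : List ℕ) : Fintype.card (Chains l) = l.sum := by
  rw [Fintype.card_sigma]
  simp

/-- With all chains of length at most two, the strict relations are the covering pairs of the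
two-element chains and form a matching. -/
theorem Nsp_eq_avoidCount (hl : ∀ i, l.get i ≤ 2) :
    (Nsp l : ℚ) = avoidCount (l.count 2) l.sum := by
  classical
  rw [Nsp_eq_numArr, ← card_coverPairs, ← card_chains, ← card_univ,
    ← numArr_matching _ _ coverPairs_ne coverPairs_disjoint]
  congr 1
  refine numArr_congr fun v _ w _ _ => ?_
  rw [chains_lt_iff, mem_coverPairs]
  have h1 := hl v.1
  have h2 := v.2.isLt
  have h3 := w.2.isLt
  constructor
  · rintro ⟨h, h'⟩
    have h4 : l.get w.1 = l.get v.1 := by rw [h]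
    exact ⟨by omega, h, by omega, by omega⟩
  · rintro ⟨-, h, h', h''⟩
    exact ⟨h, by omega⟩

theorem Nsp_cons_three (hl : ∀ i, l.get i ≤ 2) : (Nsp (3 :: l) : ℚ) =
    avoidCount (l.count 2) (l.sum + 3) - 3 * avoidCount (l.count 2) (l.sum + 2)
      + avoidCount (l.count 2) (l.sum + 1) := by
  classical
  let z : Fin (3 :: l).length := ⟨0, Nat.succ_pos _⟩
  have hz : (3 :: l).get z = 3 := rfl
  let p (k : Fin 3) : Chains (3 :: l) := ⟨z, k⟩
  have hp : ∀ k, (p k).1 = z ∧ (p k).2.val = k.val := fun k => ⟨rfl, rfl⟩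
  have hne : ∀ i j : Fin 3, i ≠ j → p i ≠ p j := fun i j hij h => hij (Fin.ext (by
    have := (chains_ext_iff.1 h).2
    rwa [(hp i).2, (hp j).2] at this))
  have hcount : (3 :: l).count 2 = l.count 2 := by simp
  have hsum : (univ : Finset (Chains (3 :: l))).card = l.sum + 3 := by
    rw [card_univ, card_chains, List.sum_cons, add_comm]
  have hne3 : ∀ i : Fin (3 :: l).length, i ≠ z → (3 :: l).get i ≤ 2 := by
    intro i hi
    obtain ⟨i, hlt⟩ := i
    match i, hlt with
    | 0, _ => exact absurd rfl hi
    | i + 1, hlt => exact hl ⟨i, Nat.lt_of_succ_lt_succ hlt⟩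
  have key := numArr_chain_matching (coverPairs (3 :: l)) univ (mem_univ (p 0)) (mem_univ (p 1))
    (mem_univ (p 2)) (hne 0 1 (by decide)) (hne 0 2 (by decide)) (hne 1 2 (by decide))
    coverPairs_ne coverPairs_disjoint (by
      intro e he v hv
      obtain ⟨h1, h2, -⟩ := mem_coverPairs.1 he
      have hv' : v.1 = z := by rcases hv with rfl | rfl | rfl <;> rfl
      have h3 : e.1.1 ≠ z := fun h => by
        rw [h, hz] at h1
        omega
      refine ⟨fun h => h3 (by rw [h, hv']), fun h => h3 (by rw [h2, h, hv'])⟩)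
  rw [card_coverPairs, hcount, hsum] at key
  rw [Nsp_eq_numArr]
  refine Eq.trans ?_ key
  congr 1
  refine numArr_congr fun v _ w _ _ => ?_
  rw [chains_lt_iff, mem_coverPairs]
  simp only [chains_ext_iff, hp]
  have h2 := v.2.isLt
  have h3 := w.2.isLt
  by_cases hv : v.1 = z
  · have hv3 : (3 :: l).get v.1 = 3 := by rw [hv]; rfl
    constructor
    · rintro ⟨h, h'⟩
      have hw : w.1 = z := by rw [← h, hv]
      have hw3 : (3 :: l).get w.1 = 3 := by rw [hw]; rfl
      have h2 := h2.trans_eq hv3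
      have h3 := h3.trans_eq hw3
      simp only [hv, hw, true_and, Fin.val_zero, Fin.val_one, Fin.val_two]
      omega
    · rintro (⟨h, -⟩ | h | h | h)
      · omega
      all_goals
        simp only [Fin.val_zero, Fin.val_one, Fin.val_two] at h
        exact ⟨by rw [h.1.1, h.2.1], by omega⟩
  · have h1 := hne3 v.1 hv
    constructor
    · rintro ⟨h, h'⟩
      have h4 : (3 :: l).get w.1 = (3 :: l).get v.1 := by rw [h]
      exact Or.inl ⟨by omega, h, by omega, by omega⟩
    · rintro (⟨-, h, h', h''⟩ | h | h | h)
      · exact ⟨h, by omega⟩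
      all_goals exact absurd h.1.1 hv

theorem Nsp321_twos (m c : ℕ) : (Nsp321 0 m c : ℚ) = avoidCount m (2 * m + c) := by
  rw [Nsp321, Nsp_eq_avoidCount]
  · congr 1
    · simp [list321, List.count_replicate]
    · simp [list321]
      ring
  · intro i
    have h : ∀ x ∈ list321 0 m c, x ≤ 2 := fun x hx => by
      simp only [list321, List.mem_append, List.mem_replicate] at hx
      omega
    exact h _ (List.get_mem (list321 0 m c) i)

theorem Nsp321_three (m : ℕ) : (Nsp321 1 m 0 : ℚ) = avoidCount m (2 * m + 3)
    - 3 * avoidCount m (2 * m + 2) + avoidCount m (2 * m + 1) := by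
  have h : list321 1 m 0 = 3 :: List.replicate m 2 := by simp [list321]
  rw [Nsp321, h, Nsp_cons_three]
  · simp [mul_comm]
  · intro i
    have := List.get_mem (List.replicate m 2) i
    exact (List.eq_of_mem_replicate this).le

/-- Prepending `x` is an injection, and it creates no forbidden succession since `x` is related to
nothing on its right. -/
theorem numArr_le_insert {V : Type*} [DecidableEq V] {S : Finset V} {x : V} (hx : x ∉ S)
    {r : V → V → Prop} (h : ∀ v, ¬ r x v) : numArr S r ≤ numArr (insert x S) r := by
  refine Set.ncard_le_ncard_of_injOn (fun s => x :: s) ?_ ?_ (arrangements_finite _ _)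
  · rintro s ⟨⟨h1, h2⟩, h3⟩
    refine ⟨⟨List.nodup_cons.2 ⟨fun hm => hx ((h2 x).1 hm), h1⟩, fun v => ?_⟩, ?_⟩
    · rw [List.mem_cons, mem_insert, h2]
    · exact List.isChain_cons.2 ⟨fun v _ => h v, h3⟩
  · intro s _ t _ hst
    exact (List.cons.inj hst).2

/-- The two sides are realised on the poset `(2^m, 1)` without and with its isolated point. This
inequality supplies Schur-positivity. -/
theorem avoidCount_le_succ (m : ℕ) : avoidCount m (2 * m) ≤ avoidCount m (2 * m + 1) := by
  classical
  rw [← Nsp321_twos m 1]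
  let l := list321 0 m 1
  have hl : l.length = m + 1 := by simp [l, list321]
  let i : Fin l.length := ⟨m, by omega⟩
  have hi : l.get i = 1 := by simp [l, i, list321]
  let x : Chains l := ⟨i, ⟨0, by omega⟩⟩
  have hx : ∀ e ∈ coverPairs l, e.1 ≠ x ∧ e.2 ≠ x := by
    intro e he
    obtain ⟨h1, h2, -⟩ := mem_coverPairs.1 he
    have h3 : e.1.1 ≠ i := fun h => by
      rw [h, hi] at h1
      omega
    exact ⟨fun h => h3 (by rw [h]), fun h => h3 (by rw [h2, h])⟩
  have hcount : (coverPairs l).card = m := by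
    rw [card_coverPairs]
    simp [l, list321]
  have hcard : (univ : Finset (Chains l)).card = 2 * m + 1 := by
    rw [card_univ, card_chains]
    simp [l, list321]
    ring
  have h1 := numArr_matching (coverPairs l) univ coverPairs_ne coverPairs_disjoint
  have h2 := numArr_matching (coverPairs l) (univ.erase x) (fun e he =>
    ⟨mem_erase.2 ⟨(hx e he).1, mem_univ _⟩, mem_erase.2 ⟨(hx e he).2, mem_univ _⟩,
      (coverPairs_ne e he).2.2⟩) coverPairs_disjoint
  rw [hcount, hcard] at h1
  rw [hcount, card_erase_of_mem (mem_univ _), hcard, Nat.add_sub_cancel] at h2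
  rw [Nsp321_twos, ← h2]
  have h3 := numArr_le_insert (S := univ.erase x) (r := fun v w => (v, w) ∈ coverPairs l)
    (notMem_erase x _) (fun v h => (hx _ h).1 rfl)
  rw [insert_erase (mem_univ x)] at h3
  rw [← h1]
  exact_mod_cast h3

end ChainsPoset

/-! ### Counting proper colourings of complete multipartite graphs -/

section Colorings

/-- The number of proper colourings of `K l` in which colour `i` is used `m i` times. -/
noncomputable def colorCount (l : List ℕ) (m : ℕ →₀ ℕ) : ℕ :=
  Nat.card {c : (K l).Coloring ℕ // (∑ v, Finsupp.single (c v) 1 : ℕ →₀ ℕ) = m}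

theorem chromSym_K_apply (l : List ℕ) (m : ℕ →₀ ℕ) :
    chromSym (K l) m = (colorCount l m : ℚ) := rfl

/-- The exponent vector counting how often each colour is used by a function. -/
noncomputable def colorWeight {V : Type*} [Fintype V] (f : V → ℕ) : ℕ →₀ ℕ := ∑ v, Finsupp.single (f v) 1

theorem colorWeight_apply {V : Type*} [Fintype V] (f : V → ℕ) (x : ℕ) :
    colorWeight f x = (univ.filter (fun v => f v = x)).card := by
  rw [colorWeight, Finsupp.finsetSum_apply, card_filter]
  simp only [Finsupp.single_apply]

theorem colorWeight_ne_zero_iff {V : Type*} [Fintype V] {f : V → ℕ} {x : ℕ} :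
    colorWeight f x ≠ 0 ↔ ∃ v, f v = x := by
  rw [colorWeight_apply, card_ne_zero]
  simp [Finset.Nonempty]

theorem degree_colorWeight {V : Type*} [Fintype V] (f : V → ℕ) :
    (colorWeight f).degree = Fintype.card V := by
  rw [colorWeight, map_sum]
  simp

theorem colorCount_eq_zero_of_degree {l : List ℕ} {m : ℕ →₀ ℕ} (h : m.degree ≠ l.sum) :
    colorCount l m = 0 := by
  rw [colorCount, Nat.card_eq_zero]
  left
  refine ⟨fun c => h ?_⟩
  rw [← c.2, ← card_chains]
  exact degree_colorWeight c.1

variable {k : ℕ} {l : List ℕ}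

/-- The inclusion of the chains of `l` into those of `k :: l`. -/
def tailVertex (k : ℕ) (v : Chains l) : Chains (k :: l) := ⟨v.1.succ, v.2⟩

/-- The elements of the first chain of `k :: l`. -/
def headVertex (l : List ℕ) (a : Fin k) : Chains (k :: l) := ⟨(0 : Fin (l.length + 1)), a⟩

theorem colorWeight_cons (c : Chains (k :: l) → ℕ) : colorWeight c =
    colorWeight (fun a => c (headVertex l a)) + colorWeight (fun v => c (tailVertex k v)) := by
  rw [colorWeight, Fintype.sum_sigma, colorWeight, colorWeight, Fintype.sum_sigma]
  exact Fin.sum_univ_succ (n := l.length)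
    (fun i : Fin (l.length + 1) => ∑ a : Fin ((k :: l).get i), Finsupp.single (c ⟨i, a⟩) 1)

/-- Combining colourings of the first chain and of the other ones. -/
def glue (f : Fin k → ℕ) (c : Chains l → ℕ) : Chains (k :: l) → ℕ
  | ⟨⟨0, _⟩, a⟩ => f a
  | ⟨⟨i + 1, h⟩, a⟩ => c ⟨⟨i, Nat.lt_of_succ_lt_succ h⟩, a⟩

theorem exists_vertex (v : Chains (k :: l)) :
    (∃ a, v = headVertex l a) ∨ ∃ w, v = tailVertex k w := by
  obtain ⟨⟨i, h⟩, a⟩ := v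
  match i, h, a with
  | 0, _, a => exact Or.inl ⟨a, rfl⟩
  | i + 1, h, a => exact Or.inr ⟨⟨⟨i, Nat.lt_of_succ_lt_succ h⟩, a⟩, rfl⟩

theorem adj_head_tail (a : Fin k) (v : Chains l) :
    (K (k :: l)).Adj (headVertex l a) (tailVertex k v) := by
  show (0 : Fin (l.length + 1)) ≠ v.1.succ
  exact (Fin.succ_ne_zero _).symm

theorem not_adj_head (a b : Fin k) :
    ¬ (K (k :: l)).Adj (headVertex l a) (headVertex l b) := fun h => h rfl

theorem adj_tail_iff (v w : Chains l) :
    (K (k :: l)).Adj (tailVertex k v) (tailVertex k w) ↔ (K l).Adj v w := by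
  show v.1.succ ≠ w.1.succ ↔ v.1 ≠ w.1
  rw [Ne, Fin.succ_inj]

/-- Vertices of the first part are adjacent to all others, so a colour used there occurs nowhere
else and its whole multiplicity is spent on that part. -/
theorem coloring_weight_split {m : ℕ →₀ ℕ} {c : (K (k :: l)).Coloring ℕ}
    (hc : colorWeight c = m) {f : Fin k → ℕ} (hf : ∀ a, c (headVertex l a) = f a) :
    (∀ a, colorWeight f (f a) = m (f a)) ∧
      colorWeight (fun v => c (tailVertex k v)) = m.filter (fun x => x ∉ univ.image f) := by
  have hsplit := colorWeight_cons (k := k) (l := l) c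
  rw [hc, funext hf] at hsplit
  have hzero : ∀ a, colorWeight (fun v => c (tailVertex k v)) (f a) = 0 := fun a => by
    by_contra h
    obtain ⟨v, hv⟩ := colorWeight_ne_zero_iff.1 h
    exact c.valid (adj_head_tail a v) (by rw [hf a, ← hv])
  refine ⟨fun a => by rw [hsplit, Finsupp.add_apply, hzero, add_zero], ?_⟩
  ext x
  rw [Finsupp.filter_apply]
  by_cases hx : x ∉ univ.image f
  · rw [if_pos hx, hsplit, Finsupp.add_apply]
    have : colorWeight f x = 0 := by
      by_contra h
      obtain ⟨a, ha⟩ := colorWeight_ne_zero_iff.1 h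
      exact hx (mem_image.2 ⟨a, mem_univ _, ha⟩)
    rw [this, zero_add]
  · rw [if_neg hx]
    obtain ⟨a, -, ha⟩ := mem_image.1 (not_not.1 hx)
    rw [← ha, hzero]

/-- The restriction of a colouring to all chains but the first. -/
def tailColoring (c : (K (k :: l)).Coloring ℕ) : (K l).Coloring ℕ :=
  SimpleGraph.Coloring.mk (fun v => c (tailVertex k v))
    fun {_ _} h => c.valid ((adj_tail_iff _ _).2 h)

/-- Extension of a colouring by colours for the first chain. -/
def glueColoring (f : Fin k → ℕ) (c : (K l).Coloring ℕ) (h : ∀ a v, f a ≠ c v) :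
    (K (k :: l)).Coloring ℕ :=
  SimpleGraph.Coloring.mk (glue f c) (by
    intro v w hvw
    rcases exists_vertex v with ⟨a, rfl⟩ | ⟨v, rfl⟩ <;>
      rcases exists_vertex w with ⟨b, rfl⟩ | ⟨w, rfl⟩
    · exact absurd hvw (not_adj_head a b)
    · exact h a w
    · exact (h b v).symm
    · exact c.valid ((adj_tail_iff _ _).1 hvw))

theorem ne_of_weight_filter {f : Fin k → ℕ} {m : ℕ →₀ ℕ} {c : Chains l → ℕ}
    (hc : colorWeight c = m.filter (fun x => x ∉ univ.image f)) (a : Fin k) (v : Chains l) :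
    f a ≠ c v := by
  intro h
  refine colorWeight_ne_zero_iff.2 ⟨v, rfl⟩ (?_ : colorWeight c (c v) = 0)
  rw [hc, Finsupp.filter_apply, if_neg]
  rw [not_not, ← h]
  exact mem_image_of_mem f (mem_univ a)

/-- Colourings which are prescribed on the first chain. -/
def coloringFiberEquiv {m : ℕ →₀ ℕ} {f : Fin k → ℕ}
    (hf : ∀ a, colorWeight f (f a) = m (f a)) :
    {c : (K (k :: l)).Coloring ℕ // colorWeight c = m ∧ ∀ a, c (headVertex l a) = f a} ≃
      {c : (K l).Coloring ℕ // colorWeight c = m.filter (fun x => x ∉ univ.image f)} where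
  toFun c := ⟨tailColoring c.1, (coloring_weight_split c.2.1 c.2.2).2⟩
  invFun c := ⟨glueColoring f c.1 (ne_of_weight_filter c.2), by
    refine ⟨?_, fun a => rfl⟩
    rw [colorWeight_cons]
    have h : (fun v => (glueColoring f c.1 (ne_of_weight_filter c.2)) (tailVertex k v)) =
      (c.1 : Chains l → ℕ) := rfl
    have h' : (fun a => (glueColoring f c.1 (ne_of_weight_filter c.2)) (headVertex l a)) =
      f := rfl
    rw [h, h', c.2]
    ext x
    rw [Finsupp.add_apply, Finsupp.filter_apply]
    by_cases hx : x ∉ univ.image f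
    · rw [if_pos hx]
      have : colorWeight f x = 0 := by
        by_contra h
        obtain ⟨a, ha⟩ := colorWeight_ne_zero_iff.1 h
        exact hx (mem_image.2 ⟨a, mem_univ _, ha⟩)
      rw [this, zero_add]
    · rw [if_neg hx]
      obtain ⟨a, -, ha⟩ := mem_image.1 (not_not.1 hx)
      rw [← ha, hf, add_zero]⟩
  left_inv c := by
    apply Subtype.ext
    apply RelHom.ext
    intro v
    rcases exists_vertex v with ⟨a, rfl⟩ | ⟨v, rfl⟩
    · exact (c.2.2 a).symm
    · rfl
  right_inv c := rfl

/-- The sum is over the colours `f` on the first part. The condition says that each colour is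
exhausted there; the other parts are coloured with the variables left over. -/
theorem colorCount_cons (k : ℕ) (l : List ℕ) (m : ℕ →₀ ℕ) : colorCount (k :: l) m =
    ∑ f : Fin k → m.support,
      if ∀ a, colorWeight (fun b => (f b : ℕ)) (f a) = m (f a) then
        colorCount l (m.filter (fun x => x ∉ univ.image (fun b => (f b : ℕ)))) else 0 := by
  classical
  have hfin := finite_colorings (K (k :: l)) m
  let g : {c : (K (k :: l)).Coloring ℕ // colorWeight c = m} → (Fin k → m.support) :=
    fun c a => ⟨c.1 (headVertex l a), by
      rw [Finsupp.mem_support_iff]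
      have h := colorWeight_ne_zero_iff.2
        (⟨headVertex l a, rfl⟩ : ∃ v, c.1 v = c.1 (headVertex l a))
      rwa [c.2] at h⟩
  have hfin' : Finite {c : (K (k :: l)).Coloring ℕ // colorWeight c = m} := hfin
  have h1 : colorCount (k :: l) m =
      Nat.card {c : (K (k :: l)).Coloring ℕ // colorWeight c = m} := rfl
  rw [h1, Nat.card_congr (Equiv.sigmaFiberEquiv g).symm, Nat.card_sigma]
  refine Fintype.sum_congr _ _ fun f => ?_
  have hg : ∀ c : {c : (K (k :: l)).Coloring ℕ // colorWeight c = m}, g c = f ↔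
      ∀ a, c.1 (headVertex l a) = f a := fun c => by
    rw [funext_iff]
    exact forall_congr' fun a => Subtype.ext_iff
  split_ifs with hf
  · have e := (Equiv.subtypeEquivRight hg).trans
      ((Equiv.subtypeSubtypeEquivSubtypeInter _ (fun c : (K (k :: l)).Coloring ℕ =>
        ∀ a, c (headVertex l a) = f a)).trans (coloringFiberEquiv hf))
    exact Nat.card_congr e
  · rw [Nat.card_eq_zero]
    left
    refine ⟨fun c => hf ?_⟩
    exact (coloring_weight_split c.1.2 ((hg c.1).1 c.2)).1

end Colorings

/-! ### Recursions removing a part of size two or three -/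

section ColorRecursion

theorem sum_fin_succ_arrow {α : Type*} [Fintype α] {n : ℕ} (F : (Fin (n + 1) → α) → ℕ) :
    ∑ f, F f = ∑ a, ∑ g : Fin n → α, F (Fin.cons a g) := by
  rw [← (Fin.consEquiv (fun _ : Fin (n + 1) => α)).sum_comp, Fintype.sum_prod_type]
  rfl

/-- The variables with exponent `k`. -/
def level (m : ℕ →₀ ℕ) (k : ℕ) : Finset ℕ := m.support.filter (fun i => m i = k)

theorem mem_level {m : ℕ →₀ ℕ} {k i : ℕ} (hk : k ≠ 0) : i ∈ level m k ↔ m i = k := by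
  rw [level, mem_filter, Finsupp.mem_support_iff]
  exact ⟨fun h => h.2, fun h => ⟨by omega, h⟩⟩

theorem card_level (m : ℕ →₀ ℕ) (k : ℕ) : (level m k).card = mult m k := rfl

/-- Removal of a set of variables from a monomial. -/
noncomputable def removeVars (m : ℕ →₀ ℕ) (B : Finset ℕ) : ℕ →₀ ℕ := m.filter (fun x => x ∉ B)

theorem removeVars_apply (m : ℕ →₀ ℕ) (B : Finset ℕ) (x : ℕ) :
    removeVars m B x = if x ∈ B then 0 else m x := by
  rw [removeVars, Finsupp.filter_apply]
  split_ifs <;> simp_all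

theorem level_removeVars (m : ℕ →₀ ℕ) (B : Finset ℕ) {k : ℕ} (hk : k ≠ 0) :
    level (removeVars m B) k = level m k \ B := by
  ext x
  rw [mem_level hk, mem_sdiff, mem_level hk, removeVars_apply]
  split_ifs with h
  · simp [h, hk.symm]
  · simp [h]

theorem removeVars_degree_add (m : ℕ →₀ ℕ) (B : Finset ℕ) :
    (removeVars m B).degree + ∑ i ∈ B, m i = m.degree := by
  have h : m = removeVars m B + m.filter (fun x => x ∈ B) := by
    rw [add_comm, removeVars, Finsupp.filter_add_filter_not]
  have h' : (m.filter (fun x => x ∈ B)).degree = ∑ i ∈ B, m i := by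
    rw [Finsupp.degree_apply]
    have hs : (m.filter (fun x => x ∈ B)).support ⊆ B := fun x hx => by
      rw [Finsupp.support_filter, mem_filter] at hx
      exact hx.2
    rw [sum_subset hs fun x _ hx => Finsupp.notMem_support_iff.1 hx]
    exact sum_congr rfl fun x hx => Finsupp.filter_apply_pos _ _ hx
  conv_rhs => rw [h]
  rw [map_add, h']

theorem sum_level (m : ℕ →₀ ℕ) (k a : ℕ) :
    ∑ i ∈ m.support, (if m i = k then a else 0) = mult m k * a := by
  rw [← sum_filter, sum_const, smul_eq_mul, mult]

theorem sum_level_pairs (m : ℕ →₀ ℕ) (b : ℕ) :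
    ∑ i ∈ m.support, ∑ j ∈ m.support, (if m i = 1 ∧ j ≠ i ∧ m j = 1 then b else 0) =
      mult m 1 * ((mult m 1 - 1) * b) := by
  rw [← sum_level]
  refine sum_congr rfl fun i _ => ?_
  split_ifs with hi
  · have h : m.support.filter (fun j => m i = 1 ∧ j ≠ i ∧ m j = 1) = (level m 1).erase i := by
      ext j
      rw [mem_filter, mem_erase, mem_level one_ne_zero, Finsupp.mem_support_iff]
      omega
    rw [← sum_filter, sum_const, h, card_erase_of_mem ((mem_level one_ne_zero).2 hi),
      smul_eq_mul, card_level]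
  · simp [hi]

theorem sum_level_triples (m : ℕ →₀ ℕ) (c : ℕ) :
    ∑ i ∈ m.support, ∑ j ∈ m.support, ∑ k ∈ m.support,
      (if (m i = 1 ∧ j ≠ i ∧ m j = 1) ∧ k ≠ i ∧ k ≠ j ∧ m k = 1 then c else 0) =
      mult m 1 * ((mult m 1 - 1) * ((mult m 1 - 2) * c)) := by
  rw [← sum_level_pairs]
  refine sum_congr rfl fun i _ => sum_congr rfl fun j _ => ?_
  split_ifs with h
  · have h' : m.support.filter (fun k => (m i = 1 ∧ j ≠ i ∧ m j = 1) ∧ k ≠ i ∧ k ≠ j ∧ m k = 1) =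
        ((level m 1).erase i).erase j := by
      ext k
      rw [mem_filter, mem_erase, mem_erase, mem_level one_ne_zero, Finsupp.mem_support_iff]
      have := Nat.one_ne_zero
      constructor
      · tauto
      · rintro ⟨h1, h2, h3⟩
        exact ⟨by omega, h, h2, h1, h3⟩
    rw [← sum_filter, sum_const, h', card_erase_of_mem, card_erase_of_mem, smul_eq_mul,
      card_level, Nat.sub_sub]
    · exact (mem_level one_ne_zero).2 h.1
    · exact mem_erase.2 ⟨h.2.1, (mem_level one_ne_zero).2 h.2.2⟩
  · simp [h]

/-- The number of colourings of `k :: l` using the colours `f` on the first chain. -/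
noncomputable def prescribedCount {k : ℕ} (l : List ℕ) (m : ℕ →₀ ℕ) (f : Fin k → ℕ) : ℕ :=
  if ∀ a, colorWeight f (f a) = m (f a) then colorCount l (removeVars m (univ.image f)) else 0

/-- A part of size two takes either one colour of multiplicity two or an ordered pair of distinct
colours of multiplicity one. -/
theorem colorCount_cons_two {l : List ℕ} {m : ℕ →₀ ℕ} {a b : ℕ}
    (ha : ∀ i ∈ level m 2, colorCount l (removeVars m {i}) = a)
    (hb : ∀ i ∈ level m 1, ∀ j ∈ level m 1, i ≠ j → colorCount l (removeVars m {i, j}) = b) :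
    colorCount (2 :: l) m = mult m 2 * a + mult m 1 * ((mult m 1 - 1) * b) := by
  have key : ∀ g : Fin 2 → ℕ, prescribedCount l m g =
      (if g 0 = g 1 then (if m (g 0) = 2 then a else 0) else 0) +
        if m (g 0) = 1 ∧ g 1 ≠ g 0 ∧ m (g 1) = 1 then b else 0 := by
    intro g
    have hB : univ.image g = {g 0, g 1} := by
      ext x
      simp [Fin.exists_fin_succ, eq_comm]
    rw [prescribedCount, hB]
    simp only [Fin.forall_fin_two, colorWeight, Fin.sum_univ_two, Finsupp.add_apply,
      Finsupp.single_apply]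
    by_cases hij : g 0 = g 1
    · rw [← hij, pair_eq_singleton]
      by_cases h2 : m (g 0) = 2
      · simp [h2, ha (g 0) ((mem_level two_ne_zero).2 h2)]
      · simp [h2, Ne.symm h2]
    · by_cases h1 : m (g 0) = 1 ∧ m (g 1) = 1
      · have := hb (g 0) ((mem_level one_ne_zero).2 h1.1) (g 1) ((mem_level one_ne_zero).2 h1.2)
          hij
        simp [hij, Ne.symm hij, h1, this]
      · have h1' : ¬ (1 = m (g 0) ∧ 1 = m (g 1)) := by omega
        have h1'' : ¬ (m (g 0) = 1 ∧ g 1 ≠ g 0 ∧ m (g 1) = 1) := by tauto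
        simp only [hij, Ne.symm hij, if_true, if_false, add_zero, zero_add]
        rw [if_neg h1', if_neg h1'']
  have h : colorCount (2 :: l) m = ∑ i : m.support, ∑ j : m.support,
      ((if (i : ℕ) = j then (if m i = 2 then a else 0) else 0) +
        if m i = 1 ∧ (j : ℕ) ≠ i ∧ m j = 1 then b else 0) := by
    rw [colorCount_cons, sum_fin_succ_arrow]
    simp only [sum_fin_succ_arrow, Fintype.sum_unique]
    exact Fintype.sum_congr _ _ fun i => Fintype.sum_congr _ _ fun j =>
      key fun c => ((Fin.cons i (Fin.cons j default) : Fin 2 → m.support) c : ℕ)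
  rw [h, sum_coe_sort m.support (fun i => ∑ j : m.support,
      ((if i = j then (if m i = 2 then a else 0) else 0) +
        if m i = 1 ∧ (j : ℕ) ≠ i ∧ m j = 1 then b else 0)),
    ← sum_level_pairs, ← sum_level, ← sum_add_distrib]
  refine sum_congr rfl fun i hi => ?_
  rw [sum_coe_sort m.support (fun j =>
      ((if i = j then (if m i = 2 then a else 0) else 0) +
        if m i = 1 ∧ j ≠ i ∧ m j = 1 then b else 0)), sum_add_distrib, sum_ite_eq, if_pos hi]

/-- The patterns on a part of size three are one colour, a pair and a single, or three distinct
singles. The factor `3` is the choice of the vertex that carries the single colour. -/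
theorem colorCount_cons_three {l : List ℕ} {m : ℕ →₀ ℕ} {a b c : ℕ}
    (ha : ∀ i ∈ level m 3, colorCount l (removeVars m {i}) = a)
    (hb : ∀ i ∈ level m 2, ∀ j ∈ level m 1, colorCount l (removeVars m {i, j}) = b)
    (hc : ∀ i ∈ level m 1, ∀ j ∈ level m 1, ∀ k ∈ level m 1, i ≠ j → i ≠ k → j ≠ k →
      colorCount l (removeVars m {i, j, k}) = c) :
    colorCount (3 :: l) m = mult m 3 * a + 3 * (mult m 2 * (mult m 1 * b)) +
      mult m 1 * ((mult m 1 - 1) * ((mult m 1 - 2) * c)) := by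
  -- One summand for each set partition of the three vertices, so that every sum over supports can
  -- be evaluated separately.
  let T (i j k : ℕ) : ℕ :=
    (if i = j then (if j = k then (if m j = 3 then a else 0) else 0) else 0) +
    (if i = j then (if m j = 2 then (if m k = 1 then b else 0) else 0) else 0) +
    (if i = k then (if m k = 2 then (if m j = 1 then b else 0) else 0) else 0) +
    (if j = k then (if m k = 2 then (if m i = 1 then b else 0) else 0) else 0) +
    (if (m i = 1 ∧ j ≠ i ∧ m j = 1) ∧ k ≠ i ∧ k ≠ j ∧ m k = 1 then c else 0)
  have key : ∀ g : Fin 3 → ℕ, prescribedCount l m g = T (g 0) (g 1) (g 2) := by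
    intro g
    have hB : univ.image g = {g 0, g 1, g 2} := by
      ext x
      simp [Fin.exists_fin_succ, eq_comm]
    have hall : ∀ P : Fin 3 → Prop, (∀ a, P a) ↔ P 0 ∧ P 1 ∧ P 2 := fun P => by
      simp [Fin.forall_fin_succ]
    rw [prescribedCount, hB]
    simp only [hall, colorWeight, Fin.sum_univ_three, Finsupp.add_apply, Finsupp.single_apply, T]
    generalize g 0 = i
    generalize g 1 = j
    generalize g 2 = k
    have hb' : ∀ i j, m i = 2 → m j = 1 → colorCount l (removeVars m {i, j}) = b :=
      fun i j hi hj => hb i ((mem_level two_ne_zero).2 hi) j ((mem_level one_ne_zero).2 hj)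
    by_cases hij : i = j
    · subst hij
      by_cases hik : i = k
      · subst hik
        by_cases h3 : m i = 3
        · simp [h3, ha i ((mem_level three_ne_zero).2 h3)]
        · have : ¬ 3 = m i := fun h => h3 h.symm
          simp only [h3, this, and_self, if_true, if_false]
          split_ifs <;> omega
      · by_cases h : m i = 2 ∧ m k = 1
        · simp [hik, Ne.symm hik, h, hb' i k h.1 h.2]
        · have h' : ¬ (2 = m i ∧ 1 = m k) := by omega
          simp [hik, Ne.symm hik]
          grind
    · by_cases hik : i = k
      · subst hik
        by_cases h : m i = 2 ∧ m j = 1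
        · have e : ({i, j, i} : Finset ℕ) = {i, j} := by ext x; simp; tauto
          rw [e]
          simp [hij, Ne.symm hij, h, hb' i j h.1 h.2]
        · simp [hij, Ne.symm hij]
          grind
      · by_cases hjk : j = k
        · subst hjk
          by_cases h : m j = 2 ∧ m i = 1
          · have e : ({i, j, j} : Finset ℕ) = {j, i} := by ext x; simp; tauto
            rw [e]
            simp [hij, Ne.symm hij, h, hb' j i h.1 h.2]
          · simp [hij, Ne.symm hij]
            grind
        · by_cases h : m i = 1 ∧ m j = 1 ∧ m k = 1
          · have := hc i ((mem_level one_ne_zero).2 h.1) j ((mem_level one_ne_zero).2 h.2.1)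
              k ((mem_level one_ne_zero).2 h.2.2) hij hik hjk
            simp [hij, hik, hjk, Ne.symm hij, Ne.symm hik, Ne.symm hjk, h, this]
          · simp [hij, hik, hjk, Ne.symm hij, Ne.symm hik, Ne.symm hjk]
            grind
  have h : colorCount (3 :: l) m = ∑ i : m.support, ∑ j : m.support, ∑ k : m.support,
      T i j k := by
    rw [colorCount_cons, sum_fin_succ_arrow]
    simp only [sum_fin_succ_arrow, Fintype.sum_unique]
    exact Fintype.sum_congr _ _ fun i => Fintype.sum_congr _ _ fun j =>
      Fintype.sum_congr _ _ fun k =>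
      key fun c => ((Fin.cons i (Fin.cons j (Fin.cons k default)) : Fin 3 → m.support) c : ℕ)
  have h' : colorCount (3 :: l) m = ∑ i ∈ m.support, ∑ j ∈ m.support, ∑ k ∈ m.support,
      T i j k := by
    rw [h, sum_coe_sort m.support (fun i => ∑ j : m.support, ∑ k : m.support, T i j k)]
    refine sum_congr rfl fun i _ => ?_
    rw [sum_coe_sort m.support (fun j => ∑ k : m.support, T i j k)]
    exact sum_congr rfl fun j _ => sum_coe_sort m.support (fun k => T i j k)
  rw [h']
  simp only [T, sum_add_distrib]
  rw [sum_level_triples]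
  have s1 : ∑ i ∈ m.support, ∑ j ∈ m.support, ∑ k ∈ m.support,
      (if i = j then (if j = k then (if m j = 3 then a else 0) else 0) else 0) =
      mult m 3 * a := by
    rw [← sum_level]
    refine sum_congr rfl fun i hi => ?_
    simp only [sum_ite_irrel, sum_const_zero, sum_ite_eq, hi, if_true]
  have s2 : ∑ i ∈ m.support, ∑ j ∈ m.support, ∑ k ∈ m.support,
      (if i = j then (if m j = 2 then (if m k = 1 then b else 0) else 0) else 0) =
      mult m 2 * (mult m 1 * b) := by
    rw [← sum_level]
    refine sum_congr rfl fun i hi => ?_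
    simp only [sum_ite_irrel, sum_const_zero, sum_ite_eq, hi, if_true, sum_level]
  have s3 : ∑ i ∈ m.support, ∑ j ∈ m.support, ∑ k ∈ m.support,
      (if i = k then (if m k = 2 then (if m j = 1 then b else 0) else 0) else 0) =
      mult m 2 * (mult m 1 * b) := by
    rw [← sum_level]
    refine sum_congr rfl fun i hi => ?_
    simp only [sum_ite_eq, hi, if_true, sum_ite_irrel, sum_const_zero, sum_level]
  have s4 : ∑ i ∈ m.support, ∑ j ∈ m.support, ∑ k ∈ m.support,
      (if j = k then (if m k = 2 then (if m i = 1 then b else 0) else 0) else 0) =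
      mult m 2 * (mult m 1 * b) := by
    rw [sum_comm, ← sum_level]
    refine sum_congr rfl fun i hi => ?_
    simp only [sum_ite_eq, hi, if_true, sum_ite_irrel, sum_const_zero, sum_level]
  rw [s1, s2, s3, s4]
  ring

end ColorRecursion

/-! ### Closed formulas for the numbers of colourings -/

section ColorFormulas

theorem mult_removeVars (m : ℕ →₀ ℕ) (B : Finset ℕ) {k : ℕ} (hk : k ≠ 0) :
    mult (removeVars m B) k = mult m k - (B.filter (fun i => m i = k)).card := by
  have h : B ∩ level m k = B.filter (fun i => m i = k) := by
    ext x
    rw [mem_inter, mem_level hk, mem_filter]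
  rw [← card_level, level_removeVars m B hk, card_sdiff, h, card_level]

theorem removeVars_le {m : ℕ →₀ ℕ} {B : Finset ℕ} {n : ℕ} (h : ∀ i, m i ≤ n) (i : ℕ) :
    removeVars m B i ≤ n := by
  rw [removeVars_apply]
  split_ifs
  · exact Nat.zero_le n
  · exact h i

theorem degree_eq_mult {m : ℕ →₀ ℕ} (h : ∀ i, m i ≤ 3) :
    m.degree = mult m 1 + 2 * mult m 2 + 3 * mult m 3 := by
  have h1 : ∀ i ∈ m.support, m i = (if m i = 1 then 1 else 0) + (if m i = 2 then 2 else 0) +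
      (if m i = 3 then 3 else 0) := fun i _ => by
    have := h i
    generalize m i = k at *
    interval_cases k <;> rfl
  rw [Finsupp.degree_apply, sum_congr rfl h1, sum_add_distrib, sum_add_distrib, sum_level,
    sum_level, sum_level]
  ring

theorem mult_eq_zero {m : ℕ →₀ ℕ} {n k : ℕ} (h : ∀ i, m i ≤ n) (hk : n < k) : mult m k = 0 := by
  rw [mult, card_eq_zero]
  refine filter_eq_empty_iff.2 fun i _ hi => ?_
  have := h i
  omega

open Classical in
/-- The number of colourings of `K (2 ^ β)` with `b` colours used once and `a` colours used
twice. -/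
theorem colorCount_replicate_two (β : ℕ) : ∀ m : ℕ →₀ ℕ, colorCount (List.replicate β 2) m =
    if m.degree = 2 * β ∧ ∀ i, m i ≤ 2 then β.descFactorial (mult m 2) * (mult m 1)! else 0 := by
  induction β with
  | zero =>
    intro m
    by_cases hm : m = 0
    · subst hm
      have h1 : colorCount (List.replicate 0 2) 0 = 1 := by
        rw [colorCount, Nat.card_eq_one_iff_unique]
        have : IsEmpty (Chains (List.replicate 0 2)) := ⟨fun v => v.1.elim0⟩
        refine ⟨⟨fun c d => Subtype.ext (RelHom.ext fun v => isEmptyElim v)⟩,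
          ⟨⟨SimpleGraph.Coloring.mk (fun _ => 0) (fun {v} => isEmptyElim v), ?_⟩⟩⟩
        exact Fintype.sum_empty _
      rw [h1]
      simp [mult]
    · have hd : m.degree ≠ 0 := fun h => hm ((Finsupp.degree_eq_zero_iff m).1 h)
      rw [if_neg (by omega), colorCount_eq_zero_of_degree (by simpa using hd)]
  | succ β ih =>
    intro m
    by_cases hdeg : m.degree = 2 * (β + 1)
    swap
    · rw [if_neg (by tauto), colorCount_eq_zero_of_degree]
      simpa [mul_comm] using hdeg
    rw [List.replicate_succ]
    have hd1 : ∀ i ∈ level m 2, (removeVars m {i}).degree = 2 * β := fun i hi => by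
      have := removeVars_degree_add m {i}
      rw [sum_singleton, (mem_level two_ne_zero).1 hi] at this
      omega
    have hd2 : ∀ i ∈ level m 1, ∀ j ∈ level m 1, i ≠ j →
        (removeVars m {i, j}).degree = 2 * β := fun i hi j hj hij => by
      have := removeVars_degree_add m {i, j}
      rw [sum_pair hij, (mem_level one_ne_zero).1 hi, (mem_level one_ne_zero).1 hj] at this
      omega
    by_cases hle : ∀ i, m i ≤ 2
    · rw [if_pos ⟨hdeg, hle⟩]
      rw [colorCount_cons_two (a := β.descFactorial (mult m 2 - 1) * (mult m 1)!)
        (b := β.descFactorial (mult m 2) * (mult m 1 - 2)!)]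
      · have hd := degree_eq_mult (m := m) fun i => (hle i).trans (by omega)
        rw [mult_eq_zero hle (by omega : 2 < 3), hdeg] at hd
        generalize mult m 1 = b at hd ⊢
        generalize mult m 2 = a at hd ⊢
        -- The recursion amounts to `(β+1)_a = (β)_a + a (β)_{a-1}` for falling factorials. Small
        -- `a` and `b` are separated only because of truncated subtraction.
        rcases a with _ | a
        · obtain ⟨b, rfl⟩ : ∃ c, b = c + 2 := ⟨b - 2, by omega⟩
          simp [Nat.factorial_succ]
        · rw [Nat.succ_descFactorial_succ, Nat.descFactorial_succ, Nat.add_sub_cancel]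
          -- The degree condition makes `b` even, so `b < 2` means `b = 0`.
          rcases Nat.lt_or_ge b 2 with hb | hb
          · have h0 : b = 0 := by omega
            have h1 : β = a := by omega
            subst h0 h1
            simp
          · obtain ⟨b, rfl⟩ : ∃ c, b = c + 2 := ⟨b - 2, by omega⟩
            obtain ⟨c, rfl⟩ : ∃ c, β = a + c := ⟨β - a, by omega⟩
            rw [Nat.add_sub_cancel_left, Nat.add_sub_cancel, show b + 2 - 1 = b + 1 by omega,
              Nat.factorial_succ, Nat.factorial_succ]
            ring
      · intro i hi
        have hi' := (mem_level two_ne_zero).1 hi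
        rw [ih, if_pos ⟨hd1 i hi, removeVars_le hle⟩, mult_removeVars _ _ two_ne_zero,
          mult_removeVars _ _ one_ne_zero]
        simp [filter_singleton, hi']
      · intro i hi j hj hij
        have hi' := (mem_level one_ne_zero).1 hi
        have hj' := (mem_level one_ne_zero).1 hj
        rw [ih, if_pos ⟨hd2 i hi j hj hij, removeVars_le hle⟩, mult_removeVars _ _ two_ne_zero,
          mult_removeVars _ _ one_ne_zero]
        simp [filter_insert, filter_singleton, hi', hj', hij]
    · rw [if_neg (by tauto)]
      push Not at hle
      obtain ⟨x, hx⟩ := hle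
      have key : ∀ B, x ∉ B → colorCount (List.replicate β 2) (removeVars m B) = 0 := by
        intro B hB
        rw [ih, if_neg]
        rintro ⟨-, h⟩
        have := h x
        rw [removeVars_apply, if_neg hB] at this
        omega
      rw [colorCount_cons_two (a := 0) (b := 0)]
      · simp
      · intro i hi
        have hi' := (mem_level two_ne_zero).1 hi
        refine key _ ?_
        rw [mem_singleton]
        rintro rfl
        omega
      · intro i hi j hj _
        have hi' := (mem_level one_ne_zero).1 hi
        have hj' := (mem_level one_ne_zero).1 hj
        refine key _ ?_
        rw [mem_insert, mem_singleton]
        rintro (rfl | rfl) <;> omega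

/-- The number of colourings of `K (3, 2 ^ β)` with `b` colours used once, `a` colours used twice
and `c` colours used three times. -/
def threeTwosCount (β b a c : ℕ) : ℕ :=
  match c with
  | 0 => b ! * (β.descFactorial a + 3 * a * β.descFactorial (a - 1))
  | 1 => b ! * β.descFactorial a
  | _ => 0

-- A colour used three times must fill the part of size three. If there is none, that part holds
-- three single colours, or one of the `a` double colours on one of its three pairs together with a
-- single colour; this is the term `3 * a`.
open Classical in
theorem colorCount_three_twos {β : ℕ} {m : ℕ →₀ ℕ} (hdeg : m.degree = 2 * β + 3) :
    colorCount (3 :: List.replicate β 2) m =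
      if ∀ i, m i ≤ 3 then threeTwosCount β (mult m 1) (mult m 2) (mult m 3) else 0 := by
  have hd1 : ∀ i ∈ level m 3, (removeVars m {i}).degree = 2 * β := fun i hi => by
    have := removeVars_degree_add m {i}
    rw [sum_singleton, (mem_level three_ne_zero).1 hi] at this
    omega
  have hd2 : ∀ i ∈ level m 2, ∀ j ∈ level m 1,
      (removeVars m {i, j}).degree = 2 * β := fun i hi j hj => by
    have := removeVars_degree_add m {i, j}
    have hi := (mem_level two_ne_zero).1 hi
    have hj := (mem_level one_ne_zero).1 hj
    rw [sum_pair (by rintro rfl; omega), hi, hj] at this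
    omega
  have hd3 : ∀ i ∈ level m 1, ∀ j ∈ level m 1, ∀ k ∈ level m 1, i ≠ j → i ≠ k → j ≠ k →
      (removeVars m {i, j, k}).degree = 2 * β := fun i hi j hj k hk hij hik hjk => by
    have := removeVars_degree_add m {i, j, k}
    have hi := (mem_level one_ne_zero).1 hi
    have hj := (mem_level one_ne_zero).1 hj
    have hk := (mem_level one_ne_zero).1 hk
    rw [sum_insert (by simp [hij, hik]), sum_pair hjk, hi, hj, hk] at this
    omega
  -- A colour of multiplicity at least three left for the parts of size two admits no colouring.
  have key : ∀ B x, x ∉ B → 3 ≤ m x →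
      colorCount (List.replicate β 2) (removeVars m B) = 0 := by
    intro B x hB hx
    rw [colorCount_replicate_two, if_neg]
    rintro ⟨-, h⟩
    have := h x
    rw [removeVars_apply, if_neg hB] at this
    omega
  have hb0 : ∀ x, 3 ≤ m x → ∀ i ∈ level m 2, ∀ j ∈ level m 1,
      colorCount (List.replicate β 2) (removeVars m {i, j}) = 0 := fun x hx i hi j hj => by
    have hi := (mem_level two_ne_zero).1 hi
    have hj := (mem_level one_ne_zero).1 hj
    refine key _ x ?_ hx
    rw [mem_insert, mem_singleton]
    rintro (rfl | rfl) <;> omega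
  have hc0 : ∀ x, 3 ≤ m x → ∀ i ∈ level m 1, ∀ j ∈ level m 1, ∀ k ∈ level m 1,
      i ≠ j → i ≠ k → j ≠ k →
      colorCount (List.replicate β 2) (removeVars m {i, j, k}) = 0 :=
    fun x hx i hi j hj k hk _ _ _ => by
    have hi := (mem_level one_ne_zero).1 hi
    have hj := (mem_level one_ne_zero).1 hj
    have hk := (mem_level one_ne_zero).1 hk
    refine key _ x ?_ hx
    rw [mem_insert, mem_insert, mem_singleton]
    rintro (rfl | rfl | rfl) <;> omega
  by_cases hle : ∀ i, m i ≤ 3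
  swap
  · rw [if_neg hle]
    push Not at hle
    obtain ⟨x, hx⟩ := hle
    rw [colorCount_cons_three (a := 0) (b := 0) (c := 0) _ (hb0 x hx.le) (hc0 x hx.le)]
    · simp
    · intro i hi
      have hi' := (mem_level three_ne_zero).1 hi
      refine key _ x ?_ hx.le
      rw [mem_singleton]
      rintro rfl
      omega
  rw [if_pos hle]
  have hd := degree_eq_mult hle
  rw [hdeg] at hd
  rcases h3 : mult m 3 with _ | _ | c
  · have hempty : level m 3 = ∅ := card_eq_zero.1 h3
    have hle2 : ∀ i, m i ≤ 2 := fun i => by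
      by_contra h
      have hi : i ∈ level m 3 := (mem_level three_ne_zero).2 (by have := hle i; omega)
      rw [hempty] at hi
      exact absurd hi (notMem_empty i)
    rw [colorCount_cons_three (a := 0)
      (b := β.descFactorial (mult m 2 - 1) * (mult m 1 - 1)!)
      (c := β.descFactorial (mult m 2) * (mult m 1 - 3)!)]
    · rw [h3] at hd
      generalize mult m 1 = b at hd ⊢
      generalize mult m 2 = a at hd ⊢
      rw [threeTwosCount]
      -- Here `b` is odd, so `b < 3` forces `b = 1` and `a = β + 1`, where the falling factorial
      -- `(β)_a` vanishes.
      rcases Nat.lt_or_ge b 3 with hb | hb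
      · have hb1 : b = 1 := by omega
        have ha : a = β + 1 := by omega
        subst hb1 ha
        simp
        ring
      · obtain ⟨b, rfl⟩ : ∃ c, b = c + 3 := ⟨b - 3, by omega⟩
        rw [Nat.add_sub_cancel, show b + 3 - 1 = b + 2 by omega, show b + 3 - 2 = b + 1 by omega,
          Nat.factorial_succ (b + 2), Nat.factorial_succ (b + 1), Nat.factorial_succ b]
        ring
    · intro i hi
      rw [hempty] at hi
      exact absurd hi (notMem_empty i)
    · intro i hi j hj
      have hi' := (mem_level two_ne_zero).1 hi
      have hj' := (mem_level one_ne_zero).1 hj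
      rw [colorCount_replicate_two, if_pos ⟨hd2 i hi j hj, removeVars_le hle2⟩,
        mult_removeVars _ _ two_ne_zero, mult_removeVars _ _ one_ne_zero]
      simp [filter_insert, filter_singleton, hi', hj']
    · intro i hi j hj k hk hij hik hjk
      have hi' := (mem_level one_ne_zero).1 hi
      have hj' := (mem_level one_ne_zero).1 hj
      have hk' := (mem_level one_ne_zero).1 hk
      rw [colorCount_replicate_two, if_pos ⟨hd3 i hi j hj k hk hij hik hjk, removeVars_le hle2⟩,
        mult_removeVars _ _ two_ne_zero, mult_removeVars _ _ one_ne_zero]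
      simp [filter_insert, filter_singleton, hi', hj', hk', hij, hik, hjk]
  · obtain ⟨x, hx⟩ := card_eq_one.1 h3
    have hx' : ∀ i, m i = 3 ↔ i = x := fun i => by
      rw [← mem_level three_ne_zero, level, hx, mem_singleton]
    have hx3 : m x = 3 := (hx' x).2 rfl
    rw [colorCount_cons_three (a := β.descFactorial (mult m 2) * (mult m 1)!) (b := 0) (c := 0) _
      (hb0 x hx3.ge) (hc0 x hx3.ge)]
    · rw [h3, threeTwosCount]
      ring
    · intro i hi
      have hi' := (mem_level three_ne_zero).1 hi
      have hle2 : ∀ j, removeVars m {i} j ≤ 2 := fun j => by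
        rw [removeVars_apply]
        split_ifs with hj
        · omega
        · have h1 := hle j
          have h2 : m j ≠ 3 := fun h => hj (mem_singleton.2 (((hx' j).1 h).trans
            ((hx' i).1 hi').symm))
          omega
      rw [colorCount_replicate_two, if_pos ⟨hd1 i hi, hle2⟩,
        mult_removeVars _ _ two_ne_zero, mult_removeVars _ _ one_ne_zero]
      simp [filter_singleton, hi']
  · obtain ⟨x, hx, y, hy, hxy⟩ := one_lt_card.1
      (show 1 < (level m 3).card by rw [card_level, h3]; omega)
    have hx3 := (mem_level three_ne_zero).1 hx
    have hy3 := (mem_level three_ne_zero).1 hy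
    rw [colorCount_cons_three (a := 0) (b := 0) (c := 0) _ (hb0 x hx3.ge) (hc0 x hx3.ge)]
    · simp [threeTwosCount]
    · intro i hi
      by_cases hix : x = i
      · exact key _ y (by rw [mem_singleton, ← hix]; exact hxy.symm) hy3.ge
      · exact key _ x (by rwa [mem_singleton]) hx3.ge

end ColorFormulas

/-! ### Schur coefficients as values of functionals -/

section Coefficients

open MvPolynomial

/-- The functional computing the coefficients of the chromatic symmetric function of
`K (3, 2 ^ β)`. -/
noncomputable def threeTwosFunctional (β : ℕ) : MvPolynomial (Fin 3) ℚ →ₗ[ℚ] ℚ :=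
  functional (fun i j k => (threeTwosCount β i j k : ℚ))

/-- The functional computing the coefficients of the chromatic symmetric function of
`K (2 ^ β)`. -/
noncomputable def twosFunctional (β : ℕ) : MvPolynomial (Fin 3) ℚ →ₗ[ℚ] ℚ :=
  functional (fun i j k => if k = 0 then ((β.descFactorial j * i ! : ℕ) : ℚ) else 0)

theorem chromSym_three_twos (β : ℕ) : chromSym (K321 1 β 0) =
    Finsupp.linearCombination ℚ schur (∑ t ∈ shapes (2 * β + 3),
      Finsupp.single (diagram t) (threeTwosFunctional β (schurDet (X 0) (X 1) (X 2) t))) := by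
  classical
  have hl : list321 1 β 0 = 3 :: List.replicate β 2 := by simp [list321]
  apply eq_linearCombination_schur
  · intro m hm
    rw [chromSym_K_apply, colorCount_eq_zero_of_degree, Nat.cast_zero]
    rw [hl]
    simp
    omega
  · intro m hm
    rw [chromSym_K_apply, hl, colorCount_three_twos hm]
    split_ifs with h
    · rw [prod_elem h, threeTwosFunctional, functional_pow]
    · push Not at h
      obtain ⟨j, hj⟩ := h
      rw [prod_elem_eq_zero hj, map_zero, Nat.cast_zero]

theorem chromSym_twos (β : ℕ) : chromSym (K321 0 β 0) =
    Finsupp.linearCombination ℚ schur (∑ t ∈ shapes (2 * β),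
      Finsupp.single (diagram t) (twosFunctional β (schurDet (X 0) (X 1) (X 2) t))) := by
  classical
  have hl : list321 0 β 0 = List.replicate β 2 := by simp [list321]
  apply eq_linearCombination_schur
  · intro m hm
    rw [chromSym_K_apply, colorCount_eq_zero_of_degree, Nat.cast_zero]
    rw [hl]
    simp
    omega
  · intro m hm
    rw [chromSym_K_apply, hl, colorCount_replicate_two]
    by_cases h : ∀ i, m i ≤ 3
    · rw [prod_elem h, twosFunctional, functional_pow]
      by_cases h2 : ∀ i, m i ≤ 2
      · rw [if_pos ⟨hm, h2⟩, if_pos (mult_eq_zero h2 (by omega))]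
      · rw [if_neg (by tauto), if_neg, Nat.cast_zero]
        intro h3
        refine h2 fun i => ?_
        by_contra hi
        have h4 : i ∈ level m 3 := (mem_level three_ne_zero).2 (by have := h i; omega)
        rw [card_eq_zero.1 (show (level m 3).card = 0 from h3)] at h4
        exact notMem_empty i h4
    · have h2 : ¬ ∀ i, m i ≤ 2 := fun h2 => h fun i => (h2 i).trans (by omega)
      push Not at h
      obtain ⟨j, hj⟩ := h
      rw [prod_elem_eq_zero hj, map_zero, if_neg (by tauto), Nat.cast_zero]

theorem schurCoeff_diagram {n : ℕ} (c : ℕ × ℕ × ℕ → ℚ) {t : ℕ × ℕ × ℕ} (ht : t ∈ shapes n) :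
    schurCoeff (diagram t) (Finsupp.linearCombination ℚ schur
      (∑ t ∈ shapes n, Finsupp.single (diagram t) (c t))) = c t := by
  rw [schurCoeff_linearCombination, Finsupp.finsetSum_apply, sum_eq_single t]
  · rw [Finsupp.single_eq_same]
  · intro s hs hst
    rw [Finsupp.single_eq_of_ne]
    exact fun h => hst (diagram_injOn n hs ht h.symm)
  · exact fun h => absurd ht h

theorem schurPositive_of_nonneg {n : ℕ} {c : ℕ × ℕ × ℕ → ℚ} (hc : ∀ t ∈ shapes n, 0 ≤ c t) :
    SchurPositive (Finsupp.linearCombination ℚ schur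
      (∑ t ∈ shapes n, Finsupp.single (diagram t) (c t))) := by
  classical
  refine ⟨?_, fun μ => ?_⟩
  · rw [Sym, ← Finsupp.range_linearCombination]
    exact ⟨_, rfl⟩
  · rw [schurCoeff_linearCombination, Finsupp.finsetSum_apply]
    refine sum_nonneg fun t ht => ?_
    rw [Finsupp.single_apply]
    split_ifs
    · exact hc t ht
    · exact le_rfl

/-- Passage from row lengths to column lengths, which index the Schur polynomials. -/
theorem shape321_eq_diagram (a C D : ℕ) : shape321 a C D = diagram (a + C + D, a + C, a) := by
  ext ⟨i, j⟩
  rw [YoungDiagram.mem_cells, YoungDiagram.mem_cells, shape321, YoungDiagram.mem_ofRowLens,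
    diagram, mem_threeCol]
  have hlen : (list321 a C D).length = a + (C + D) := by simp [list321]
  have hget : ∀ h : i < (list321 a C D).length,
      (list321 a C D)[i] = if i < a then 3 else if i < a + C then 2 else 1 := by
    intro h
    simp only [list321, List.getElem_append, List.length_replicate, List.getElem_replicate]
    split_ifs <;> omega
  simp only
  constructor
  · rintro ⟨h, h'⟩
    rw [hget h] at h'
    split_ifs at h' <;> omega
  · intro h
    have hi : i < (list321 a C D).length := by omega
    refine ⟨hi, ?_⟩
    rw [hget hi]
    split_ifs <;> omega

/-! ### Evaluation of the coefficients -/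

theorem cast_choose_mul_factorial {D k : ℕ} (h : 2 * k ≤ D) :
    (((D - k).choose k : ℕ) : ℚ) * ((D - 2 * k)! : ℚ) = ((D - k)! : ℚ) / (k ! : ℚ) := by
  rw [eq_div_iff (by positivity)]
  have := Nat.choose_mul_factorial_mul_factorial (show k ≤ D - k by omega)
  rw [show D - k - k = D - 2 * k by omega] at this
  rw [← this]
  push_cast
  ring

theorem cast_descFactorial_eq {β M C k : ℕ} (h : C + M = β) (hk : k ≤ M) :
    (β.descFactorial (C + k) : ℚ) = (β ! : ℚ) / ((M - k)! : ℚ) := by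
  rw [eq_div_iff (by positivity), mul_comm]
  have := Nat.factorial_mul_descFactorial (show C + k ≤ β by omega)
  rw [show β - (C + k) = M - k by omega] at this
  exact_mod_cast this

/-- Reduction of an alternating sum to the number of arrangements avoiding `M` successions. -/
theorem sum_eq_avoidCount {n M D : ℕ} (hn : M ≤ n) (x : ℚ) (F : ℕ → ℚ)
    (h₁ : ∀ k ≤ M, F k = x / (((M - k)! : ℚ) * (k ! : ℚ)) * ((D - k)! : ℚ))
    (h₀ : ∀ k, M < k → k ≤ n → F k = 0) :
    ∑ k ∈ range (n + 1), (-1) ^ k * F k = x / (M ! : ℚ) * avoidCount M D := by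
  rw [avoidCount, mul_sum, ← sum_subset (range_mono (Nat.succ_le_succ hn))]
  · refine sum_congr rfl fun k hk => ?_
    have hk' : k ≤ M := Nat.lt_succ_iff.1 (mem_range.1 hk)
    rw [h₁ k hk', Nat.cast_choose ℚ hk']
    have : (M ! : ℚ) ≠ 0 := by positivity
    field_simp
  · intro k hk hk'
    rw [mem_range] at hk hk'
    rw [h₀ k (by omega) (by omega), mul_zero]

/-- Absorption `k C(N+1, k) = (N+1) C(N, k-1)`; the shift of `k` produces the sign. -/
theorem sum_mul_avoid (N s : ℕ) :
    ∑ k ∈ range (N + 2), (-1) ^ k * ((N + 1).choose k : ℚ) * ((s + 1 - k)! : ℚ) * (k : ℚ) =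
      - (N + 1) * avoidCount N s := by
  rw [sum_range_succ', avoidCount, mul_sum]
  simp only [Nat.cast_zero, mul_zero, add_zero]
  refine sum_congr rfl fun k _ => ?_
  have h := Nat.add_one_mul_choose_eq N k
  have h' : ((N : ℚ) + 1) * (N.choose k : ℚ) = ((N + 1).choose (k + 1) : ℚ) * (k + 1) := by
    exact_mod_cast h
  rw [show s + 1 - (k + 1) = s - k by omega]
  push_cast
  linear_combination (-1) ^ k * ((s - k)! : ℚ) * h'

/-- The factorial `(D-2k)!` cancels against the binomial coefficient, leaving `(D-k)! / k!`. The
falling factorial contributes `β! / (M-k)!` and cuts the sum off at `k = M`. -/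
theorem sum_twoVar_descFactorial {β M C D : ℕ} (h : C + M = β) (hD : 2 * M ≤ D) :
    ∑ k ∈ range (D + 1), (-1) ^ k * ((D - k).choose k : ℚ) *
      (((D - 2 * k)! * β.descFactorial (C + k) : ℕ) : ℚ) =
      (β ! : ℚ) / (M ! : ℚ) * avoidCount M D := by
  rw [← sum_eq_avoidCount (show M ≤ D by omega) (β ! : ℚ) (fun k => ((D - k).choose k : ℚ) *
      (((D - 2 * k)! * β.descFactorial (C + k) : ℕ) : ℚ))]
  · simp only [mul_assoc]
  · intro k hk
    rw [Nat.cast_mul, ← mul_assoc, cast_choose_mul_factorial (by omega),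
      cast_descFactorial_eq h hk]
    field_simp
  · intro k hk _
    rw [Nat.descFactorial_of_lt (by omega)]
    simp

theorem threeTwosFunctional_sq_mul (β : ℕ) (Z : MvPolynomial (Fin 3) ℚ) :
    threeTwosFunctional β (X 2 ^ 2 * Z) = 0 := by
  refine functional_mul_pow_eq_zero (fun i j k hk => ?_) Z
  obtain ⟨k, rfl⟩ := Nat.exists_eq_add_of_le' hk
  rw [threeTwosCount, Nat.cast_zero]
  all_goals omega

theorem twosFunctional_mul (β : ℕ) (Z : MvPolynomial (Fin 3) ℚ) :
    twosFunctional β (X 2 * Z) = 0 := by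
  rw [← pow_one (X 2)]
  exact functional_mul_pow_eq_zero (fun i j k hk => if_neg (by omega)) Z

theorem twosFunctional_schurDet {β C D : ℕ} (h : 2 * C + D = 2 * β) :
    twosFunctional β (schurDet (X 0) (X 1) (X 2) (C + D, C, 0)) =
      (β ! : ℚ) / ((β - C)! : ℚ) * avoidCount (β - C) (2 * (β - C)) := by
  obtain ⟨Z, hZ⟩ := schurDet_mod (X 0) (X 1) (X 2 : MvPolynomial (Fin 3) ℚ) C D
  have hD : D = 2 * (β - C) := by omega
  have hw := functional_twoVar
    (fun i j k => if k = 0 then ((β.descFactorial j * i ! : ℕ) : ℚ) else 0) 0 C 0 D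
  rw [pow_zero, pow_zero, one_mul, mul_one] at hw
  rw [hZ, map_add, twosFunctional_mul, add_zero, twosFunctional, hw, ← hD,
    ← sum_twoVar_descFactorial (show C + (β - C) = β by omega) (show 2 * (β - C) ≤ D by omega)]
  refine sum_congr rfl fun k _ => ?_
  rw [if_pos rfl, zero_add, mul_comm (β.descFactorial _)]

theorem threeTwosFunctional_mul_twoVar {β C D : ℕ} (h : 2 * C + D = 2 * β) :
    threeTwosFunctional β (X 1 ^ C * X 2 * twoVar (X 0) (X 1) D) =
      (β ! : ℚ) / ((β - C)! : ℚ) * avoidCount (β - C) (2 * (β - C)) := by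
  have hD : D = 2 * (β - C) := by omega
  have hw := functional_twoVar (fun i j k => (threeTwosCount β i j k : ℚ)) 0 C 1 D
  rw [pow_zero, pow_one, one_mul] at hw
  rw [threeTwosFunctional, hw, ← hD,
    ← sum_twoVar_descFactorial (show C + (β - C) = β by omega) (show 2 * (β - C) ≤ D by omega)]
  refine sum_congr rfl fun k _ => ?_
  rw [threeTwosCount, zero_add]

/-- The full row of three cells splits off as `e₃`. On multiples of `e₃`, modulo `e₃²`, the weights
are those of `K_{(2^β)}`, whence the same value as in `twosFunctional_schurDet`. -/
theorem threeTwosFunctional_schurDet_succ {β C D : ℕ} (h : 2 * C + D = 2 * β) :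
    threeTwosFunctional β (schurDet (X 0) (X 1) (X 2) (1 + C + D, 1 + C, 1)) =
      (β ! : ℚ) / ((β - C)! : ℚ) * avoidCount (β - C) (2 * (β - C)) := by
  obtain ⟨Z, hZ⟩ := schurDet_mod (X 0) (X 1) (X 2 : MvPolynomial (Fin 3) ℚ) C D
  have hs := schurDet_succ (X 0) (X 1) (X 2 : MvPolynomial (Fin 3) ℚ) (C + D) C 0
  rw [show 1 + C + D = C + D + 1 by omega, add_comm 1 C]
  rw [zero_add] at hs
  rw [hs, hZ, show X 2 * (X 1 ^ C * twoVar (X 0) (X 1) D + X 2 * Z) =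
    X 1 ^ C * X 2 * twoVar (X 0) (X 1) D + X 2 ^ 2 * (Z : MvPolynomial (Fin 3) ℚ) by ring,
    map_add, threeTwosFunctional_sq_mul, add_zero, threeTwosFunctional_mul_twoVar h]

/-- The contribution of the colourings in which a double colour lies in the part of size three.
Writing the extra factor as `C + k`, the summand with `k` is evaluated by `sum_mul_avoid`. -/
theorem sum_twoVar_mul_descFactorial {β N C : ℕ} (h : C + N = β + 1) :
    ∑ k ∈ range (2 * N + 1 + 1), (-1) ^ k * ((2 * N + 1 - k).choose k : ℚ) *
      (((2 * N + 1 - 2 * k)! * ((C + k) * β.descFactorial (C + k - 1)) : ℕ) : ℚ) =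
      (β ! : ℚ) / (N ! : ℚ) *
        (C * avoidCount N (2 * N + 1) - N * avoidCount (N - 1) (2 * N)) := by
  have hterm : ∀ k ≤ N, ((2 * N + 1 - k).choose k : ℚ) *
      (((2 * N + 1 - 2 * k)! * ((C + k) * β.descFactorial (C + k - 1)) : ℕ) : ℚ) =
      (β ! : ℚ) / (N ! : ℚ) * ((N.choose k : ℚ) * ((2 * N + 1 - k)! : ℚ) * (C + k)) := by
    intro k hk
    rw [Nat.cast_mul, ← mul_assoc, cast_choose_mul_factorial (by omega), Nat.cast_mul,
      Nat.cast_add]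
    -- For `C + k = 0` the index `C + k - 1` is truncated, but the factor `C + k` removes the term.
    rcases Nat.eq_zero_or_pos (C + k) with h0 | h0
    · have : ((C : ℚ) + k) = 0 := by exact_mod_cast h0
      rw [this]
      ring
    · have hd : (β.descFactorial (C + k - 1) : ℚ) = (β ! : ℚ) / ((N - k)! : ℚ) := by
        rw [eq_div_iff (by positivity), mul_comm]
        have := Nat.factorial_mul_descFactorial (show C + k - 1 ≤ β by omega)
        rw [show β - (C + k - 1) = N - k by omega] at this
        exact_mod_cast this
      rw [hd, Nat.cast_choose ℚ hk]
      have : (N ! : ℚ) ≠ 0 := by positivity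
      field_simp
  rw [← sum_subset (range_mono (show N + 1 ≤ 2 * N + 1 + 1 by omega))]
  · have e1 : ∀ k ∈ range (N + 1), (-1) ^ k * ((2 * N + 1 - k).choose k : ℚ) *
        (((2 * N + 1 - 2 * k)! * ((C + k) * β.descFactorial (C + k - 1)) : ℕ) : ℚ) =
        (β ! : ℚ) / (N ! : ℚ) * (C * ((-1) ^ k * (N.choose k : ℚ) * ((2 * N + 1 - k)! : ℚ)) +
          (-1) ^ k * (N.choose k : ℚ) * ((2 * N + 1 - k)! : ℚ) * k) := fun k hk => by
      rw [mul_assoc, hterm k (Nat.lt_succ_iff.1 (mem_range.1 hk))]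
      ring
    rw [sum_congr rfl e1, ← mul_sum, sum_add_distrib, ← mul_sum, ← avoidCount]
    rcases N with _ | N
    · simp
    · rw [sum_mul_avoid, Nat.add_sub_cancel]
      push_cast
      ring
  · intro k hk hk'
    rw [mem_range] at hk hk'
    rw [Nat.descFactorial_of_lt (show β < C + k - 1 by omega)]
    simp

theorem threeTwosFunctional_twoVar {β N C : ℕ} (h : C + N = β + 1) :
    threeTwosFunctional β (X 1 ^ C * twoVar (X 0) (X 1) (2 * N + 1)) =
      (if C ≤ β then (β ! : ℚ) / ((β - C)! : ℚ) * avoidCount (β - C) (2 * N + 1) else 0) +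
      3 * ((β ! : ℚ) / (N ! : ℚ) *
        (C * avoidCount N (2 * N + 1) - N * avoidCount (N - 1) (2 * N))) := by
  have hw := functional_twoVar (fun i j k => (threeTwosCount β i j k : ℚ)) 0 C 0 (2 * N + 1)
  rw [pow_zero, pow_zero, mul_one, one_mul] at hw
  have hfirst : ∑ k ∈ range (2 * N + 1 + 1), (-1) ^ k * ((2 * N + 1 - k).choose k : ℚ) *
      (((2 * N + 1 - 2 * k)! * β.descFactorial (C + k) : ℕ) : ℚ) =
      (if C ≤ β then (β ! : ℚ) / ((β - C)! : ℚ) * avoidCount (β - C) (2 * N + 1) else 0) := by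
    split_ifs with hC
    · exact sum_twoVar_descFactorial (by omega) (by omega)
    · refine sum_eq_zero fun k _ => ?_
      rw [Nat.descFactorial_of_lt (by omega)]
      simp
  rw [threeTwosFunctional, hw, ← hfirst, ← sum_twoVar_mul_descFactorial h, mul_sum,
    ← sum_add_distrib]
  refine sum_congr rfl fun k _ => ?_
  rw [threeTwosCount, zero_add]
  push_cast
  ring

/-- The factor `n - k + 1` of `twoVarDeriv` raises `(n-k)!` to `(n-k+1)!`, so the count concerns one
object more. -/
theorem threeTwosFunctional_linearPart {β N C : ℕ} (h : C + N = β + 1) :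
    threeTwosFunctional β (X 1 ^ C * X 2 * linearPart (X 0) (X 1) (2 * N + 1)) =
      if C ≤ β then (β ! : ℚ) / ((β - C)! : ℚ) * avoidCount (β - C) (2 * (β - C) + 1) else 0 := by
  split_ifs with hC
  · obtain ⟨M, rfl⟩ : ∃ M, N = M + 1 := ⟨N - 1, by omega⟩
    have hM : β - C = M := by omega
    rw [hM, show 2 * (M + 1) + 1 = 2 * M + 3 by ring, linearPart]
    have hw := functional_twoVarDeriv (fun i j k => (threeTwosCount β i j k : ℚ)) C 1 (2 * M)
    rw [pow_one] at hw
    rw [threeTwosFunctional, hw, ← sum_eq_avoidCount (show M ≤ 2 * M by omega) (β ! : ℚ)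
      (fun k => (((2 * M - k + 1) * (2 * M - k).choose k : ℕ) : ℚ) *
        (threeTwosCount β (2 * M - 2 * k) (C + k) 1 : ℚ))]
    · simp only [mul_assoc]
    · intro k hk
      rw [threeTwosCount, Nat.cast_mul, Nat.cast_mul]
      rw [show 2 * M + 1 - k = 2 * M - k + 1 by omega, Nat.factorial_succ,
        cast_descFactorial_eq (show C + M = β by omega) hk]
      have := cast_choose_mul_factorial (show 2 * k ≤ 2 * M by omega)
      have hmul : ∀ a b c d : ℚ, a * b * (c * d) = a * (b * c) * d := fun _ _ _ _ => by ring
      rw [hmul, this]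
      push_cast
      field_simp
    · intro k hk _
      rw [threeTwosCount, Nat.descFactorial_of_lt (by omega)]
      simp
  · have hN : N = 0 := by omega
    subst hN
    simp [linearPart]

/-- The additional `e₁` supplies a factor `2N + 2 - 2k = 2 (N + 1 - k)`. Its second part cancels in
`(N + 1 - k)!`, and the `2` remains. -/
theorem threeTwosFunctional_mul_mul_twoVar {β N C : ℕ} (h : C + 2 + N = β + 1) :
    threeTwosFunctional β (X 0 * X 1 ^ C * X 2 * twoVar (X 0) (X 1) (2 * N + 1)) =
      2 * ((β ! : ℚ) / (N ! : ℚ) * avoidCount N (2 * N + 1)) := by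
  have hw := functional_twoVar (fun i j k => (threeTwosCount β i j k : ℚ)) 1 C 1 (2 * N + 1)
  rw [pow_one, pow_one] at hw
  rw [threeTwosFunctional, hw, ← mul_assoc, ← mul_div_assoc,
    ← sum_eq_avoidCount (show N ≤ 2 * N + 1 by omega) (2 * (β ! : ℚ))
      (fun k => ((2 * N + 1 - k).choose k : ℚ) *
        (threeTwosCount β (1 + (2 * N + 1 - 2 * k)) (C + k) 1 : ℚ))]
  · simp only [mul_assoc]
  · intro k hk
    have hd := cast_descFactorial_eq (show C + (N + 1) = β by omega) (show k ≤ N + 1 by omega)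
    have hc := cast_choose_mul_factorial (show 2 * k ≤ 2 * N + 1 by omega)
    rw [show N + 1 - k = N - k + 1 by omega, Nat.factorial_succ] at hd
    rw [threeTwosCount, add_comm 1 (2 * N + 1 - 2 * k), Nat.factorial_succ,
      show 2 * N + 1 - 2 * k + 1 = 2 * (N - k + 1) by omega, Nat.cast_mul, Nat.cast_mul, hd]
    have hmul : ∀ a b c d : ℚ, a * (b * c * d) = a * c * (b * d) := fun _ _ _ _ => by ring
    rw [hmul, hc]
    push_cast
    field_simp
  · intro k hk _
    rw [Nat.choose_eq_zero_of_lt (by omega)]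
    simp

/-- The constant term in `e₃` gives the first two counts in `Nsp321_three`, and the linear term
gives the third. -/
theorem threeTwosFunctional_schurDet_row (β : ℕ) :
    threeTwosFunctional β (schurDet (X 0) (X 1) (X 2) (2 * β + 3, 0, 0)) =
      (Nsp321 1 β 0 : ℚ) := by
  obtain ⟨Z, hZ⟩ := complete_mod_sq (X 0) (X 1) (X 2 : MvPolynomial (Fin 3) ℚ) (2 * β + 3)
  have h1 := threeTwosFunctional_twoVar (show 0 + (β + 1) = β + 1 by omega)
  have h2 := threeTwosFunctional_linearPart (show 0 + (β + 1) = β + 1 by omega)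
  rw [pow_zero, one_mul] at h1 h2
  rw [schurDet_row, hZ, map_add, map_add, threeTwosFunctional_sq_mul,
    show 2 * β + 3 = 2 * (β + 1) + 1 by ring, h1, h2, Nsp321_three]
  have hβ : (β ! : ℚ) ≠ 0 := by positivity
  rw [Nat.factorial_succ]
  push_cast
  simp only [Nat.zero_le, if_true, Nat.sub_zero]
  rw [show 2 * (β + 1) + 1 = 2 * β + 3 by ring, show 2 * (β + 1) = 2 * β + 2 by ring]
  field_simp
  ring

theorem threeTwosFunctional_schurDet {β N C : ℕ} (hC : 1 ≤ C) (h : C + N = β + 1) :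
    threeTwosFunctional β (schurDet (X 0) (X 1) (X 2) (C + (2 * N + 1), C, 0)) =
      (β ! : ℚ) / (N ! : ℚ) * ((N : ℚ) * (if C ≤ β then (Nsp321 1 (β - C) 0 : ℚ) else 0)
        - (Nsp321 0 N 0 : ℚ) + ((C : ℚ) + 2) * (Nsp321 0 N 1 : ℚ)) := by
  -- The expansion modulo `e₃²`, uniformly in `C`: for `C = 1` the last term is absent and
  -- `schurDet_mod_sq_one` applies.
  have key : threeTwosFunctional β (schurDet (X 0) (X 1) (X 2) (C + (2 * N + 1), C, 0)) =
      threeTwosFunctional β (X 1 ^ C * twoVar (X 0) (X 1) (2 * N + 1)) +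
      threeTwosFunctional β (X 1 ^ C * X 2 * linearPart (X 0) (X 1) (2 * N + 1)) -
      (β ! : ℚ) / (N ! : ℚ) * avoidCount N (2 * N) -
      ((C : ℚ) - 1) * (2 * ((β ! : ℚ) / (N ! : ℚ) * avoidCount N (2 * N + 1))) := by
    obtain ⟨C, rfl⟩ : ∃ c, C = c + 1 := ⟨C - 1, by omega⟩
    have h3 := threeTwosFunctional_mul_twoVar (show 2 * C + 2 * N = 2 * β by omega)
    rw [show β - C = N by omega] at h3
    rw [← h3]
    rcases C with _ | C
    · obtain ⟨Z, hZ⟩ := schurDet_mod_sq_one (X 0) (X 1) (X 2 : MvPolynomial (Fin 3) ℚ) (2 * N)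
      rw [zero_add, show 1 + (2 * N + 1) = 2 * N + 2 by omega, hZ, map_add,
        threeTwosFunctional_sq_mul]
      rw [show X 1 * twoVar (X 0) (X 1) (2 * N + 1) +
        X 2 * (X 1 * linearPart (X 0) (X 1) (2 * N + 1) - twoVar (X 0) (X 1) (2 * N)) =
        X 1 * twoVar (X 0) (X 1) (2 * N + 1) + X 1 * X 2 * linearPart (X 0) (X 1) (2 * N + 1) -
        (X 2 * twoVar (X 0) (X 1) (2 * N) : MvPolynomial (Fin 3) ℚ) by ring, map_sub, map_add]
      simp
    · obtain ⟨Z, hZ⟩ := schurDet_mod_sq (X 0) (X 1) (X 2 : MvPolynomial (Fin 3) ℚ) C (2 * N)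
      rw [← threeTwosFunctional_mul_mul_twoVar (show C + 2 + N = β + 1 by omega), hZ, map_add,
        threeTwosFunctional_sq_mul, show X 1 ^ (C + 2) * twoVar (X 0) (X 1) (2 * N + 1) +
        X 2 * (X 1 ^ (C + 2) * linearPart (X 0) (X 1) (2 * N + 1) -
          X 1 ^ (C + 1) * twoVar (X 0) (X 1) (2 * N) -
          ((C : MvPolynomial (Fin 3) ℚ) + 1) *
            (X 0 * X 1 ^ C * twoVar (X 0) (X 1) (2 * N + 1))) =
        X 1 ^ (C + 2) * twoVar (X 0) (X 1) (2 * N + 1) +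
        X 1 ^ (C + 2) * X 2 * linearPart (X 0) (X 1) (2 * N + 1) -
        X 1 ^ (C + 1) * X 2 * twoVar (X 0) (X 1) (2 * N) -
        ((C + 1 : ℕ) : ℚ) • (X 0 * X 1 ^ C * X 2 * twoVar (X 0) (X 1) (2 * N + 1) :
          MvPolynomial (Fin 3) ℚ) by
          rw [Nat.cast_smul_eq_nsmul, nsmul_eq_mul]
          push_cast
          ring, map_sub, map_sub, map_add, map_smul]
      simp
  rw [key, threeTwosFunctional_twoVar h, threeTwosFunctional_linearPart h, Nsp321_twos,
    Nsp321_twos]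
  split_ifs with hC'
  -- The three counts avoiding `M` successions combine to `N` times `Nsp321 1 M 0`. The counts
  -- avoiding `N` successions among `2N + 1` objects have total coefficient `3C - 2(C - 1) = C + 2`.
  · obtain ⟨M, rfl⟩ : ∃ M, N = M + 1 := ⟨N - 1, by omega⟩
    rw [show β - C = M by omega, Nsp321_three, Nat.factorial_succ, Nat.add_sub_cancel,
      show 2 * (M + 1) + 1 = 2 * M + 3 by ring, show 2 * (M + 1) = 2 * M + 2 by ring]
    have hM : (M ! : ℚ) ≠ 0 := by positivity
    push_cast
    field_simp
    ring
  · have hN : N = 0 := by omega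
    subst hN
    simp
    ring

end Coefficients

/-! ### Non-negativity of all Schur coefficients -/

section Positivity

open MvPolynomial

/-- The cases follow the number `r` of rows of length three: for `r ≥ 2` a factor `e₃²` splits off
and the value is zero, and for `r = 1` or for a single column it is visibly non-negative. -/
theorem threeTwosFunctional_nonneg {β : ℕ} {t : ℕ × ℕ × ℕ} (ht : t ∈ shapes (2 * β + 3)) :
    0 ≤ threeTwosFunctional β (schurDet (X 0) (X 1) (X 2) t) := by
  obtain ⟨p, q, r⟩ := t
  obtain ⟨h1, h2, h3⟩ := mem_shapes.1 ht
  simp only at h1 h2 h3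
  rcases r with _ | _ | r
  · rcases q with _ | q
    · rw [show p = 2 * β + 3 by omega, threeTwosFunctional_schurDet_row]
      positivity
    · have hN : q + 1 + (β - q) = β + 1 := by omega
      have hp : p = q + 1 + (2 * (β - q) + 1) := by omega
      rw [hp, threeTwosFunctional_schurDet (by omega) hN]
      -- The negative term is dominated by one copy of `Nsp321 0 (β - q) 1`, which occurs with
      -- coefficient at least three.
      have hle := avoidCount_le_succ (β - q)
      have h0 := Nsp321_twos (β - q) 0
      rw [← Nsp321_twos (β - q) 1, ← add_zero (2 * (β - q)), ← h0] at hle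
      have hnn : (0 : ℚ) ≤ (Nsp321 0 (β - q) 1 : ℚ) := by positivity
      have hq : (0 : ℚ) ≤ ((q + 1 : ℕ) : ℚ) := by positivity
      have hfst : (0 : ℚ) ≤ ((β - q : ℕ) : ℚ) *
          (if q + 1 ≤ β then (Nsp321 1 (β - (q + 1)) 0 : ℚ) else 0) := by
        split_ifs <;> positivity
      refine mul_nonneg (by positivity) ?_
      nlinarith
  · obtain ⟨q, rfl⟩ : ∃ c, q = 1 + c := ⟨q - 1, by omega⟩
    obtain ⟨D, rfl⟩ : ∃ D, p = 1 + q + D := ⟨p - (1 + q), by omega⟩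
    rw [zero_add, threeTwosFunctional_schurDet_succ (by omega), ← add_zero (2 * (β - q)),
      ← Nsp321_twos]
    positivity
  · obtain ⟨q, rfl⟩ : ∃ c, q = c + 1 + 1 := ⟨q - 2, by omega⟩
    obtain ⟨p, rfl⟩ : ∃ c, p = c + 1 + 1 := ⟨p - 2, by omega⟩
    rw [schurDet_succ, schurDet_succ, ← mul_assoc, ← pow_two, threeTwosFunctional_sq_mul]

end Positivity

end ChromSchur

theorem theorem4p8 (β : ℕ) (hβ : 1 ≤ β) :
    -- `K_{(3,2^β)}` is Schur-positive
    ChromSchur.SchurPositive (ChromSchur.chromSym (ChromSchur.K321 1 β 0)) ∧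
    -- shapes `(3,2^C,1^D)`
    (∀ C D : ℕ, 2 * C + D = 2 * β →
      ChromSchur.schurCoeff (ChromSchur.shape321 1 C D)
          (ChromSchur.chromSym (ChromSchur.K321 1 β 0)) =
        ChromSchur.schurCoeff (ChromSchur.shape321 0 C D)
          (ChromSchur.chromSym (ChromSchur.K321 0 β 0)) ∧
      ChromSchur.schurCoeff (ChromSchur.shape321 0 C D)
          (ChromSchur.chromSym (ChromSchur.K321 0 β 0)) =
        (β ! : ℚ) / ((β - C) ! : ℚ) * (ChromSchur.Nsp321 0 (β - C) 0 : ℚ)) ∧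
    -- shapes `(2^C,1^D)` with `C, D ≥ 1`; here `C ≤ β + 1`, so `β + 1 - C` is not truncated
    (∀ C D : ℕ, 1 ≤ C → 1 ≤ D → 2 * C + D = 2 * β + 3 →
      ChromSchur.schurCoeff (ChromSchur.shape321 0 C D)
          (ChromSchur.chromSym (ChromSchur.K321 1 β 0)) =
        (β ! : ℚ) / ((β + 1 - C) ! : ℚ) *
          (((β : ℚ) - (C : ℚ) + 1) *
              (if C ≤ β then (ChromSchur.Nsp321 1 (β - C) 0 : ℚ) else 0)
            - (ChromSchur.Nsp321 0 (β + 1 - C) 0 : ℚ)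
            + ((C : ℚ) + 2) * (ChromSchur.Nsp321 0 (β + 1 - C) 1 : ℚ))) ∧
    -- the shape `1^{2β+3}`
    ChromSchur.schurCoeff (ChromSchur.shape321 0 0 (2 * β + 3))
        (ChromSchur.chromSym (ChromSchur.K321 1 β 0)) =
      (ChromSchur.Nsp321 1 β 0 : ℚ) := by
  open ChromSchur in
  rw [chromSym_three_twos, chromSym_twos]
  refine ⟨schurPositive_of_nonneg fun t ht => threeTwosFunctional_nonneg ht, ?_, ?_, ?_⟩
  · intro C D h
    have h0 := twosFunctional_schurDet h
    rw [← add_zero (2 * (β - C)), ← Nsp321_twos] at h0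
    have h1 := threeTwosFunctional_schurDet_succ h
    rw [← add_zero (2 * (β - C)), ← Nsp321_twos] at h1
    rw [shape321_eq_diagram, shape321_eq_diagram, schurCoeff_diagram, schurCoeff_diagram,
      zero_add, h0, h1]
    · exact ⟨rfl, rfl⟩
    · exact mem_shapes.2 (by dsimp only; omega)
    · exact mem_shapes.2 (by dsimp only; omega)
  · intro C D hC hD h
    -- Since `D ≥ 1`, the degree equation gives `C ≤ β + 1`; it also makes `D` odd.
    have hN : C + (β + 1 - C) = β + 1 := by omega
    have hD' : D = 2 * (β + 1 - C) + 1 := by omega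
    rw [shape321_eq_diagram, schurCoeff_diagram, zero_add, hD',
      threeTwosFunctional_schurDet hC hN]
    · rw [show ((β + 1 - C : ℕ) : ℚ) = (β : ℚ) - C + 1 by
        rw [Nat.cast_sub (by omega)]
        push_cast
        ring]
    · exact mem_shapes.2 (by dsimp only; omega)
  · rw [shape321_eq_diagram, schurCoeff_diagram, zero_add, zero_add,
      threeTwosFunctional_schurDet_row]
    exact mem_shapes.2 (by dsimp only; omega)
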